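/- **Theorem (mode stability in the upper half-plane).** Let $M>0$ and $a,Q\in\mathbb R$ with $a^2+Q^2<M^2$. Put $r_\pm=M\pm\sqrt{M^2-a^2-Q^2}$, $\Delta=r^2-2Mr+a^2+Q^2$, $\rho^2=r^2+a^2\cos^2\theta$, and let $r^*$ be a function on $(r_+,\infty)$ with $\frac{dr^*}{dr}=\frac{r^2+a^2}{\Delta}$. On $\mathcal M=\{(t,r,\theta,\phi)\in\mathbb R\times(r_+,\infty)\times\mathbb S^2\}$ the wave equation of the Kerr–Newman metric is $$\frac1{\rho^2}\Big[\Big(a^2\sin^2\theta-\frac{(a^2+r^2)^2}{\Delta}\Big)\partial_t^2\psi-\frac{a^2}{\Delta}\partial_\phi^2\psi-\frac{2a(r^2+a^2-\Delta)}{\Delta}\partial_t\partial_\phi\psi+\partial_r(\Delta\,\partial_r\psi)+\frac1{\sin\theta}\partial_\theta(\sin\theta\,\partial_\theta\psi)+\frac1{\sin^2\theta}\partial_\phi^2\psi\Big]=0.$$ Let $\omega\in\mathbb C\setminus\{0\}$ and $m\in\mathbb Z$. A smooth solution $\psi:\mathcal M\to\mathbb C$ of this equation is called a mode solution with frequency $\omega$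 and azimuthal number $m$ if $\psi=R(r)\,S(\theta)\,e^{im\phi}e^{-i\omega t}$, where for some $\lambda\in\mathbb C$: 1. $S\not\equiv0$ is an eigenfunction with eigenvalue $\lambda$ of the angular problem $$\frac1{\sin\theta}\frac{d}{d\theta}\Big(\sin\theta\frac{dS}{d\theta}\Big)-\Big(\frac{m^2}{\sin^2\theta}-a^2\omega^2\cos^2\theta\Big)S+\lambda S=0\quad\text{on }(0,\pi),$$ with the boundary condition that $e^{im\phi}S(\theta)$ extends smoothly to $\mathbb S^2$; 2. $R$ solves on $(r_+,\infty)$ $$\frac{d}{dr}\Big(\Delta\frac{dR}{dr}\Big)+\Big[-\omega^2\Big(a^2-\frac{(a^2+r^2)^2}{\Delta}\Big)+\frac{a^2m^2}{\Delta}-\frac{2am\omega(2Mr-Q^2)}{\Delta}-\lambda\Big]R=0;$$ 3. $R(r)\,(r-r_+)^{-\xi}$, with $\xi=\frac{i(am-(2Mr_+-Q^2)\omega)}{r_+-r_-}$, is smooth up to and including $r=r_+$; 4. there are constants $C_0,C_1,\dots\in\mathbb C$ such that for every $N\ge1$, as $r\to\infty$, $$R=\frac{e^{i\omega r^*}}{r}\sum_{k=0}^N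 C_kr^{-k}+O(r^{-N-2}).$$ If $\operatorname{Im}\omega>0$, then every mode solution with frequency $\omega$ (for any $m\in\mathbb Z$ and any eigenvalue $\lambda$) vanishes identically on $\mathcal M$. -/

import Mathlib

namespace KerrNewman

open Set Filter Asymptotics Metric
open scoped Manifold Topology

noncomputable section

/-- Subextremal parameters: mass `M > 0`, specific angular momentum `a` and charge `Q` with
`a² + Q² < M²`. -/
def Subextremal (M a Q : ℝ) : Prop := 0 < M ∧ a ^ 2 + Q ^ 2 < M ^ 2

/-- The outer root `r₊` of `Δ` (event horizon). -/
def rPlus (M a Q : ℝ) : ℝ := M + Real.sqrt (M ^ 2 - a ^ 2 - Q ^ 2)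

/-- The inner root `r₋` of `Δ`. -/
def rMinus (M a Q : ℝ) : ℝ := M - Real.sqrt (M ^ 2 - a ^ 2 - Q ^ 2)

/-- `Δ(r) = r² - 2 M r + a² + Q²`. -/
def horizonFn (M a Q r : ℝ) : ℝ := r ^ 2 - 2 * M * r + a ^ 2 + Q ^ 2

/-- `ρ² = r² + a² cos² θ`. -/
def rhoSq (a r θ : ℝ) : ℝ := r ^ 2 + a ^ 2 * Real.cos θ ^ 2

theorem horizonFn_eq {M a Q : ℝ} (h : Subextremal M a Q) (r : ℝ) :
    horizonFn M a Q r = (r - rPlus M a Q) * (r - rMinus M a Q) := by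
  have h1 : 0 ≤ M ^ 2 - a ^ 2 - Q ^ 2 := by have := h.2; linarith
  have h2 := Real.sq_sqrt h1
  unfold horizonFn rPlus rMinus
  linear_combination h2

/-- The tortoise coordinate `r*` on `(r₊, ∞)`, with the additive constant fixed so that
`r* = r + ((r₊² + a²) log (r - r₊) - (r₋² + a²) log (r - r₋)) / (r₊ - r₋)`. -/
def rStar (M a Q r : ℝ) : ℝ :=
  r + ((rPlus M a Q ^ 2 + a ^ 2) * Real.log (r - rPlus M a Q)
      - (rMinus M a Q ^ 2 + a ^ 2) * Real.log (r - rMinus M a Q))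
        / (rPlus M a Q - rMinus M a Q)

/-- The defining property of the tortoise coordinate: `dr*/dr = (r² + a²) / Δ` on `(r₊, ∞)`. -/
theorem hasDerivAt_rStar {M a Q r : ℝ} (h : Subextremal M a Q) (hr : rPlus M a Q < r) :
    HasDerivAt (rStar M a Q) ((r ^ 2 + a ^ 2) / horizonFn M a Q r) r := by
  have hs : 0 < Real.sqrt (M ^ 2 - a ^ 2 - Q ^ 2) :=
    Real.sqrt_pos.2 (by have := h.2; linarith)
  have hd : 0 < rPlus M a Q - rMinus M a Q := by unfold rPlus rMinus; linarith
  have hp : r - rPlus M a Q ≠ 0 := by linarith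
  have hm : r - rMinus M a Q ≠ 0 := by linarith
  have e1 : HasDerivAt (fun x : ℝ => Real.log (x - rPlus M a Q)) (1 / (r - rPlus M a Q)) r :=
    ((hasDerivAt_id r).sub_const _).log hp
  have e2 : HasDerivAt (fun x : ℝ => Real.log (x - rMinus M a Q)) (1 / (r - rMinus M a Q)) r :=
    ((hasDerivAt_id r).sub_const _).log hm
  have e := (hasDerivAt_id r).add
    (((e1.const_mul (rPlus M a Q ^ 2 + a ^ 2)).sub
      (e2.const_mul (rMinus M a Q ^ 2 + a ^ 2))).div_const (rPlus M a Q - rMinus M a Q))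
  refine e.congr_deriv ?_
  rw [horizonFn_eq h]
  have hd' := hd.ne'
  field_simp
  ring

/-- The unit sphere `𝕊²`, with the smooth structure that Mathlib gives it. -/
abbrev Sph : Type := sphere (0 : EuclideanSpace ℝ (Fin 3)) 1

/-- The dimension fact on which the smooth structure of the sphere `𝕊²` rests. -/
instance factFinrankThree : Fact (Module.finrank ℝ (EuclideanSpace ℝ (Fin 3)) = 2 + 1) :=
  ⟨by simp⟩

/-- The point of `𝕊²` with polar angle `θ` and azimuth `φ`. -/
def sphPoint (θ φ : ℝ) : Sph :=
  ⟨!₂[Real.sin θ * Real.cos φ, Real.sin θ * Real.sin φ, Real.cos θ], by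
    rw [mem_sphere_zero_iff_norm, EuclideanSpace.norm_eq, Real.sqrt_eq_one]
    simp only [Fin.sum_univ_three, Real.norm_eq_abs, sq_abs]
    simp
    linear_combination Real.sin θ ^ 2 * Real.sin_sq_add_cos_sq φ + Real.sin_sq_add_cos_sq θ⟩

/-- The exterior region `ℝ × (r₊, ∞) × 𝕊²`, as a subset of `ℝ × ℝ × 𝕊²`. -/
def exterior (M a Q : ℝ) : Set (ℝ × ℝ × Sph) := {x | rPlus M a Q < x.2.1}

/-- A function on `ℝ × ℝ × 𝕊²`, read in Boyer–Lindquist coordinates `(t, r, θ, φ)`. -/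
def inCoords (ψ : ℝ × ℝ × Sph → ℂ) (t r θ φ : ℝ) : ℂ := ψ (t, r, sphPoint θ φ)

/-- The Laplacian of the unit sphere in polar coordinates. -/
def sphLaplacian (f : ℝ → ℝ → ℂ) (θ φ : ℝ) : ℂ :=
  (1 / Real.sin θ : ℝ) *
      deriv (fun θ' : ℝ => (Real.sin θ' : ℂ) * deriv (fun θ'' : ℝ => f θ'' φ) θ') θ
    + (1 / Real.sin θ ^ 2 : ℝ) * iteratedDeriv 2 (fun φ' : ℝ => f θ φ') φ

/-- The wave operator of the Kerr–Newman metric in Boyer–Lindquist coordinates. -/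
def waveOp (M a Q : ℝ) (f : ℝ → ℝ → ℝ → ℝ → ℂ) (t r θ φ : ℝ) : ℂ :=
  (1 / rhoSq a r θ : ℝ) *
    ((a ^ 2 * Real.sin θ ^ 2 - (a ^ 2 + r ^ 2) ^ 2 / horizonFn M a Q r : ℝ) *
        iteratedDeriv 2 (fun t' : ℝ => f t' r θ φ) t
      - (a ^ 2 / horizonFn M a Q r : ℝ) * iteratedDeriv 2 (fun φ' : ℝ => f t r θ φ') φ
      - (2 * a * (r ^ 2 + a ^ 2 - horizonFn M a Q r) / horizonFn M a Q r : ℝ) *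
          deriv (fun t' : ℝ => deriv (fun φ' : ℝ => f t' r θ φ') φ) t
      + deriv (fun r' : ℝ => (horizonFn M a Q r' : ℂ) * deriv (fun r'' : ℝ => f t r'' θ φ) r') r
      + sphLaplacian (f t r) θ φ)

/-- `ψ` is smooth on the exterior region and solves the wave equation there. -/
def IsSmoothWaveSolution (M a Q : ℝ) (ψ : ℝ × ℝ × Sph → ℂ) : Prop :=
  ContMDiffOn (𝓘(ℝ, ℝ).prod (𝓘(ℝ, ℝ).prod (𝓡 2))) 𝓘(ℝ, ℂ) ((⊤ : ℕ∞) : WithTop ℕ∞) ψ (exterior M a Q) ∧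
    ∀ t r θ φ : ℝ, rPlus M a Q < r → θ ∈ Ioo 0 Real.pi →
      waveOp M a Q (inCoords ψ) t r θ φ = 0

/-- `S` is an eigenfunction, with eigenvalue `lam`, of the angular Sturm–Liouville problem:
it is not identically zero, it solves the angular equation on `(0, π)`, and `e^{imφ} S(θ)` extends
smoothly to `𝕊²`. For non-real `ω` the eigenvalue is in general complex. -/
def IsAngularEigenfunction (a : ℝ) (ω : ℂ) (m : ℤ) (lam : ℂ) (S : ℝ → ℂ) : Prop :=
  (∃ θ ∈ Ioo 0 Real.pi, S θ ≠ 0) ∧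
  ContDiffOn ℝ 2 S (Ioo 0 Real.pi) ∧
  (∀ θ ∈ Ioo 0 Real.pi,
    (1 / Real.sin θ : ℝ) * deriv (fun θ' : ℝ => (Real.sin θ' : ℂ) * deriv S θ') θ
      - ((m : ℂ) ^ 2 / (Real.sin θ : ℂ) ^ 2 - (a : ℂ) ^ 2 * ω ^ 2 * (Real.cos θ : ℂ) ^ 2) * S θ
      + lam * S θ = 0) ∧
  ∃ Y : Sph → ℂ, ContMDiff (𝓡 2) 𝓘(ℝ, ℂ) ((⊤ : ℕ∞) : WithTop ℕ∞) Y ∧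
    ∀ θ ∈ Ioo 0 Real.pi, ∀ φ : ℝ,
      Y (sphPoint θ φ) = Complex.exp (Complex.I * m * φ) * S θ

/-- `R` is a (classical) solution of the radial equation on `(r₊, ∞)`. -/
def IsRadialSolution (M a Q : ℝ) (ω : ℂ) (m : ℤ) (lam : ℂ) (R : ℝ → ℂ) : Prop :=
  ContDiffOn ℝ 2 R (Ioi (rPlus M a Q)) ∧
  ∀ r : ℝ, rPlus M a Q < r →
    deriv (fun r' : ℝ => (horizonFn M a Q r' : ℂ) * deriv R r') r
      + (-(ω ^ 2 * ((a : ℂ) ^ 2 - ((a : ℂ) ^ 2 + (r : ℂ) ^ 2) ^ 2 / (horizonFn M a Q r : ℂ)))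
          + (a : ℂ) ^ 2 * (m : ℂ) ^ 2 / (horizonFn M a Q r : ℂ)
          - 2 * a * m * ω * (2 * M * r - (Q : ℂ) ^ 2) / (horizonFn M a Q r : ℂ)
          - lam) * R r = 0

/-- The horizon exponent `i (a m - (2 M r₊ - Q²) ω) / (r₊ - r₋)`. -/
def horizonExponent (M a Q : ℝ) (ω : ℂ) (m : ℤ) : ℂ :=
  Complex.I * ((a : ℂ) * m - (2 * M * rPlus M a Q - Q ^ 2 : ℝ) * ω)
    / (rPlus M a Q - rMinus M a Q : ℝ)

/-- Horizon boundary condition: `R(r) (r - r₊)^{-ξ}`, with `ξ` the horizon exponent, is smooth up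
to and including `r = r₊`. -/
def HorizonRegular (M a Q : ℝ) (ω : ℂ) (m : ℤ) (R : ℝ → ℂ) : Prop :=
  ∃ g : ℝ → ℂ, ContDiffOn ℝ ((⊤ : ℕ∞) : WithTop ℕ∞) g (Ici (rPlus M a Q)) ∧
    ∀ r : ℝ, rPlus M a Q < r →
      g r = R r * ((r - rPlus M a Q : ℝ) : ℂ) ^ (-horizonExponent M a Q ω m)

/-- Boundary condition at infinity: there are constants `C_k` such that for every `N ≥ 1`,
`R = (e^{iωr*} / r) ∑_{k=0}^N C_k r^{-k} + O(r^{-N-2})` as `r → ∞`. -/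
def Outgoing (M a Q : ℝ) (ω : ℂ) (R : ℝ → ℂ) : Prop :=
  ∃ C : ℕ → ℂ, ∀ N : ℕ, 1 ≤ N →
    (fun r : ℝ => R r - Complex.exp (Complex.I * ω * rStar M a Q r) / r *
        ∑ k ∈ Finset.range (N + 1), C k / (r : ℂ) ^ k)
      =O[atTop] (fun r : ℝ => (r ^ (N + 2))⁻¹)

/-- `ψ` is a mode solution of the wave equation with frequency `ω` and azimuthal number `m`.
The remaining label `ℓ` of a mode enumerates the eigenvalues `lam` of the angular problem;
all of them are admitted. -/
def IsModeSolution (M a Q : ℝ) (ω : ℂ) (m : ℤ) (ψ : ℝ × ℝ × Sph → ℂ) : Prop :=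
  ω ≠ 0 ∧ IsSmoothWaveSolution M a Q ψ ∧
  ∃ (R S : ℝ → ℂ) (lam : ℂ),
    (∀ t r θ φ : ℝ, rPlus M a Q < r → θ ∈ Ioo 0 Real.pi →
      inCoords ψ t r θ φ =
        R r * S θ * Complex.exp (Complex.I * m * φ) * Complex.exp (-(Complex.I * ω * t))) ∧
    IsAngularEigenfunction a ω m lam S ∧
    IsRadialSolution M a Q ω m lam R ∧
    HorizonRegular M a Q ω m R ∧
    Outgoing M a Q ω R

end

end KerrNewman

/-! It suffices to show R = 0. Put `y = r - r₋`, `d = r₊ - r₋`, `b = r₋`; then Δ = y(y - d) and the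
radial equation reads (ΔR')' + (K²/Δ + μ)R = 0 with K = ω(r² + a²) - am. Multiplying by `conj ω *
conj R` and taking imaginary parts fails as an energy argument: Im(ω̄K²) contains the superradiant
term -a²m² Im ω, of the wrong sign.

Whiting's remedy is an integral transformation. With W'/W = -iK/Δ, the function g = WR solves a
confluent Heun equation with polynomial coefficients, vanishes at `y = d`, and grows more slowly
than exp(2 Im ω y). Its Laplace transform along the ray p = -2iωs/d, s > d, solves another confluent
Heun equation, in which K² is replaced by terms at most linear in am. After multiplication by ω̄
these contribute a real multiple of am, which drops out of the imaginary part. The resulting flux is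
then monotone and tends to zero at both ends, so the transform vanishes on the ray
(`eq_zero_of_transformed_radial_equation`). Analytic continuation and Fourier inversion give g = 0
(`eq_zero_of_laplaceMoment_eq_zero_on_ray`), hence R = 0.

The sign Im(ω̄λ) ≤ 0 needed for the flux comes from the same argument on the angular equation
(`IsAngularEigenfunction.im_conj_mul_nonpos`). -/

namespace KerrNewman

open Set Filter Asymptotics Metric MeasureTheory
open scoped Topology FourierTransform ComplexConjugate Manifold

/-! ### Laplace transforms on a half-line: analyticity, decay, injectivity. -/

/-- The moments `∫_d^∞ y^j e^{-p y} g(y) dy` of the Laplace transform of `g` on `(d, ∞)`. -/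
noncomputable def laplaceMoment (d : ℝ) (g : ℝ → ℂ) (j : ℕ) (p : ℂ) : ℂ :=
  ∫ y in Ioi d, (y : ℂ) ^ j * Complex.exp (-p * y) * g y

theorem integrableOn_pow_mul_exp_neg (d : ℝ) (j : ℕ) {δ : ℝ} (hδ : 0 < δ) :
    IntegrableOn (fun y : ℝ => y ^ j * Real.exp (-δ * y)) (Ioi d) := by
  refine integrable_of_isBigO_exp_neg (b := δ / 2) (half_pos hδ) (by fun_prop) ?_
  have h := (isLittleO_pow_exp_pos_mul_atTop (k := j) (half_pos hδ)).isBigO.mul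
    (isBigO_refl (fun y : ℝ => Real.exp (-δ * y)) atTop)
  refine h.congr_right fun y => ?_
  rw [← Real.exp_add]
  ring_nf

theorem norm_pow_mul_cexp_mul_le {d κ C : ℝ} {g : ℝ → ℂ} (hd : 0 ≤ d)
    (hb : ∀ y, d < y → ‖g y‖ ≤ C * Real.exp (κ * y)) (j : ℕ) {δ : ℝ} {p : ℂ}
    (hp : κ + δ ≤ p.re) {y : ℝ} (hy : d < y) :
    ‖(y : ℂ) ^ j * Complex.exp (-p * y) * g y‖ ≤ C * (y ^ j * Real.exp (-δ * y)) := by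
  have hy0 : 0 ≤ y := hd.trans hy.le
  have hC : 0 ≤ C := by
    have := (norm_nonneg _).trans (hb y hy)
    exact nonneg_of_mul_nonneg_left this (Real.exp_pos _)
  rw [norm_mul, norm_mul, norm_pow, Complex.norm_real, Real.norm_of_nonneg hy0, Complex.norm_exp]
  have h1 : (-p * (y : ℂ)).re = -(p.re * y) := by simp
  rw [h1]
  calc y ^ j * Real.exp (-(p.re * y)) * ‖g y‖
      ≤ y ^ j * Real.exp (-(p.re * y)) * (C * Real.exp (κ * y)) := by
        gcongr; exact hb y hy
    _ = C * (y ^ j * Real.exp (-(p.re * y) + κ * y)) := by rw [Real.exp_add]; ring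
    _ ≤ C * (y ^ j * Real.exp (-δ * y)) := by
        gcongr
        nlinarith

theorem aestronglyMeasurable_laplace {d : ℝ} {g : ℝ → ℂ} (hg : ContinuousOn g (Ioi d)) (j : ℕ)
    (p : ℂ) : AEStronglyMeasurable (fun y : ℝ => (y : ℂ) ^ j * Complex.exp (-p * y) * g y)
      (volume.restrict (Ioi d)) :=
  (ContinuousOn.mul (by fun_prop) hg).aestronglyMeasurable measurableSet_Ioi

theorem integrableOn_laplace {d κ C : ℝ} {g : ℝ → ℂ} (hd : 0 ≤ d) (hg : ContinuousOn g (Ioi d))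
    (hb : ∀ y, d < y → ‖g y‖ ≤ C * Real.exp (κ * y)) (j : ℕ) {p : ℂ} (hp : κ < p.re) :
    IntegrableOn (fun y : ℝ => (y : ℂ) ^ j * Complex.exp (-p * y) * g y) (Ioi d) := by
  refine Integrable.mono' ((integrableOn_pow_mul_exp_neg d j (sub_pos.2 hp)).const_mul C)
    (aestronglyMeasurable_laplace hg j p) ?_
  refine (ae_restrict_iff' measurableSet_Ioi).2 (ae_of_all _ fun y hy => ?_)
  exact norm_pow_mul_cexp_mul_le hd hb j (by linarith) hy

theorem hasDerivAt_laplaceMoment {d κ C : ℝ} {g : ℝ → ℂ} (hd : 0 ≤ d)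
    (hg : ContinuousOn g (Ioi d)) (hb : ∀ y, d < y → ‖g y‖ ≤ C * Real.exp (κ * y)) (j : ℕ)
    {p : ℂ} (hp : κ < p.re) :
    HasDerivAt (laplaceMoment d g j) (-laplaceMoment d g (j + 1) p) p := by
  have hδ : 0 < (p.re - κ) / 2 := by linarith
  have key := (hasDerivAt_integral_of_dominated_loc_of_deriv_le (μ := volume.restrict (Ioi d))
    (F := fun (p : ℂ) (y : ℝ) => (y : ℂ) ^ j * Complex.exp (-p * y) * g y)
    (F' := fun (p : ℂ) (y : ℝ) => -((y : ℂ) ^ (j + 1) * Complex.exp (-p * y) * g y)) (x₀ := p)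
    (s := {z : ℂ | κ + (p.re - κ) / 2 < z.re})
    (bound := fun y => C * (y ^ (j + 1) * Real.exp (-((p.re - κ) / 2) * y)))
    ((isOpen_lt continuous_const Complex.continuous_re).mem_nhds
      (show κ + (p.re - κ) / 2 < p.re by linarith))
    (.of_forall fun z => aestronglyMeasurable_laplace hg j z)
    (integrableOn_laplace hd hg hb j hp) (aestronglyMeasurable_laplace hg (j + 1) p).neg
    ?_ ((integrableOn_pow_mul_exp_neg d (j + 1) hδ).const_mul C) ?_).2
  · rw [integral_neg] at key
    exact key
  · refine (ae_restrict_iff' measurableSet_Ioi).2 (ae_of_all _ fun y hy z hz => ?_)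
    rw [norm_neg]
    exact norm_pow_mul_cexp_mul_le hd hb (j + 1) (le_of_lt hz) hy
  · refine ae_of_all _ fun y z _ => ?_
    have h1 : HasDerivAt (fun z : ℂ => -z * (y : ℂ)) (-(y : ℂ)) z := by
      simpa using (hasDerivAt_id z).neg.mul_const (y : ℂ)
    refine ((h1.cexp.const_mul ((y : ℂ) ^ j)).mul_const (g y)).congr_deriv ?_
    ring

/-- Only `y > d` contributes, so increasing `p.re` beyond `p₀` gains at least the factor exp(-(p.re
- p₀)d). -/
theorem norm_laplaceMoment_le {d κ C : ℝ} {g : ℝ → ℂ} (hd : 0 ≤ d)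
    (hb : ∀ y, d < y → ‖g y‖ ≤ C * Real.exp (κ * y)) (j : ℕ)
    {p₀ : ℝ} (hp₀ : κ < p₀) :
    ∃ B, ∀ p : ℂ, p₀ ≤ p.re → ‖laplaceMoment d g j p‖ ≤ B * Real.exp (-(p.re * d)) := by
  have hint : Integrable (fun y : ℝ => C * (y ^ j * Real.exp (-(p₀ - κ) * y)))
      (volume.restrict (Ioi d)) :=
    (integrableOn_pow_mul_exp_neg d j (sub_pos.2 hp₀)).const_mul C
  refine ⟨(∫ y in Ioi d, C * (y ^ j * Real.exp (-(p₀ - κ) * y))) * Real.exp (p₀ * d),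
    fun p hp => ?_⟩
  rw [mul_assoc, ← Real.exp_add]
  unfold laplaceMoment
  rw [← integral_mul_const]
  refine norm_integral_le_of_norm_le (hint.mul_const _) ?_
  refine (ae_restrict_iff' measurableSet_Ioi).2 (ae_of_all _ fun y hy => ?_)
  have hy' : d < y := hy
  refine (norm_pow_mul_cexp_mul_le hd hb j (δ := p.re - κ) (by linarith) hy).trans ?_
  have hC : 0 ≤ C := by
    have := (norm_nonneg _).trans (hb y hy)
    exact nonneg_of_mul_nonneg_left this (Real.exp_pos _)
  have hy0 : 0 ≤ y := hd.trans hy'.le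
  rw [mul_assoc, mul_assoc, ← Real.exp_add]
  gcongr
  nlinarith

/-- On the vertical line Re p = κ + 1 the Laplace transform is the Fourier transform of an
integrable function, so Fourier inversion applies at points of continuity. -/
theorem eq_zero_of_laplaceMoment_eq_zero {d κ C : ℝ} {g : ℝ → ℂ} (hd : 0 ≤ d)
    (hg : ContinuousOn g (Ioi d)) (hb : ∀ y, d < y → ‖g y‖ ≤ C * Real.exp (κ * y))
    (h0 : ∀ p : ℂ, κ < p.re → laplaceMoment d g 0 p = 0) {y : ℝ} (hy : d < y) : g y = 0 := by
  set f : ℝ → ℂ := (Ioi d).indicator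
    (fun y : ℝ => (y : ℂ) ^ 0 * Complex.exp (-((κ + 1 : ℝ) : ℂ) * y) * g y) with hf
  have hint : Integrable f := by
    rw [hf, integrable_indicator_iff measurableSet_Ioi]
    exact integrableOn_laplace hd hg hb 0 (by simp)
  have hF : 𝓕 f = 0 := by
    funext w
    rw [Real.fourier_real_eq_integral_exp_smul]
    have := h0 ((κ + 1 : ℝ) + (2 * Real.pi * w : ℝ) * Complex.I) (by simp)
    rw [laplaceMoment, ← integral_indicator measurableSet_Ioi] at this
    rw [Pi.zero_apply, ← this]
    congr 1
    funext v
    by_cases hv : v ∈ Ioi d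
    · simp only [hf, indicator_of_mem hv, smul_eq_mul, pow_zero, one_mul]
      rw [← mul_assoc, ← Complex.exp_add]
      congr 2
      push_cast
      ring
    · simp only [hf, indicator_of_notMem hv, smul_zero]
  have hcont : ContinuousAt f y := by
    have h1 : ContinuousAt (fun y : ℝ => (y : ℂ) ^ 0 * Complex.exp (-((κ + 1 : ℝ) : ℂ) * y) * g y)
        y := ContinuousAt.mul (by fun_prop) (hg.continuousAt (Ioi_mem_nhds hy))
    refine h1.congr ?_
    filter_upwards [Ioi_mem_nhds hy] with z hz
    rw [hf, indicator_of_mem hz]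
  have key := hint.fourierInv_fourier_eq (by rw [hF]; exact integrable_zero _ _ _) hcont
  rw [hF] at key
  have h2 : f y = 0 := by
    rw [← key, Real.fourierInv_eq']
    simp
  rw [hf, indicator_of_mem (show y ∈ Ioi d from hy)] at h2
  simpa using h2

/-- The transform is analytic on the half-plane Re p > κ, which contains the ray; zeros accumulating
at s = d + 1 force it to vanish there identically. -/
theorem eq_zero_of_laplaceMoment_eq_zero_on_ray {d κ C : ℝ} {g : ℝ → ℂ} (hd : 0 ≤ d)
    (hg : ContinuousOn g (Ioi d)) (hb : ∀ y, d < y → ‖g y‖ ≤ C * Real.exp (κ * y)) {c : ℂ}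
    (hc : 0 < c.re) (hκ : κ < c.re * d)
    (h0 : ∀ s : ℝ, d < s → laplaceMoment d g 0 (c * s) = 0) {y : ℝ} (hy : d < y) : g y = 0 := by
  refine eq_zero_of_laplaceMoment_eq_zero hd hg hb (fun p hp => ?_) hy
  set U : Set ℂ := {z : ℂ | κ < z.re} with hU
  have hUo : IsOpen U := isOpen_lt continuous_const Complex.continuous_re
  have hA : AnalyticOnNhd ℂ (laplaceMoment d g 0) U :=
    DifferentiableOn.analyticOnNhd (fun z hz =>
      (hasDerivAt_laplaceMoment hd hg hb 0 hz).differentiableAt.differentiableWithinAt) hUo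
  have hUc : IsPreconnected U := (convex_halfSpace_re_gt κ).isPreconnected
  have hz₀ : c * ((d + 1 : ℝ) : ℂ) ∈ U := by
    have h1 : (c * ((d + 1 : ℝ) : ℂ)).re = c.re * (d + 1) := by rw [Complex.re_mul_ofReal]
    rw [hU, mem_ofPred_eq, h1]
    nlinarith
  refine hA.eqOn_zero_of_preconnected_of_frequently_eq_zero hUc hz₀ ?_ hp
  have ht : Tendsto (fun s : ℝ => c * (s : ℂ)) (𝓝[>] (d + 1)) (𝓝[≠] (c * ((d + 1 : ℝ) : ℂ))) := by
    refine tendsto_nhdsWithin_iff.2 ⟨?_, ?_⟩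
    · exact ((by fun_prop : Continuous fun s : ℝ => c * (s : ℂ)).tendsto (d + 1)).mono_left
        nhdsWithin_le_nhds
    · filter_upwards [self_mem_nhdsWithin] with s hs h
      have hc0 : c ≠ 0 := by
        rintro rfl
        simp at hc
      have := Complex.ofReal_injective (mul_left_cancel₀ hc0 h)
      exact (ne_of_gt hs) this
  refine ht.frequently (Eventually.frequently ?_)
  filter_upwards [self_mem_nhdsWithin] with s hs
  have hs' : d + 1 < s := hs
  exact h0 s (by linarith)

/-! ### Monotone fluxes and the transformed radial equation. -/

/-- An antitone function with the same limit at both ends is constant. The filters stand for the two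
ends of the interval, so that both (d, ∞) and (0, π) are covered. -/
theorem deriv_eq_zero_of_nonpos_of_tendsto_zero {I : Set ℝ} (hI : Convex ℝ I) (hIo : IsOpen I)
    {l₁ l₂ : Filter ℝ} [l₁.NeBot] [l₂.NeBot] (h₁ : ∀ x ∈ I, ∀ᶠ y in l₁, y ∈ I ∧ y ≤ x)
    (h₂ : ∀ x ∈ I, ∀ᶠ y in l₂, y ∈ I ∧ x ≤ y) {G G' : ℝ → ℝ}
    (hG : ∀ x ∈ I, HasDerivAt G (G' x) x) (hG' : ∀ x ∈ I, G' x ≤ 0)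
    (ht₁ : Tendsto G l₁ (𝓝 0)) (ht₂ : Tendsto G l₂ (𝓝 0)) {x : ℝ} (hx : x ∈ I) : G' x = 0 := by
  have hanti : AntitoneOn G I := by
    refine antitoneOn_of_deriv_nonpos hI
      (fun x hx => (hG x hx).continuousAt.continuousWithinAt)
      (fun x hx => (hG x (interior_subset hx)).differentiableAt.differentiableWithinAt)
      fun x hx => ?_
    rw [(hG x (interior_subset hx)).deriv]
    exact hG' x (interior_subset hx)
  have hzero : ∀ x ∈ I, G x = 0 := by
    intro x hx
    refine le_antisymm ?_ ?_
    · refine ge_of_tendsto ht₁ ?_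
      filter_upwards [h₁ x hx] with y hy using hanti hy.1 hx hy.2
    · refine le_of_tendsto ht₂ ?_
      filter_upwards [h₂ x hx] with y hy using hanti hx hy.1 hy.2
  have hc : HasDerivAt G 0 x := by
    refine (hasDerivAt_const x (0 : ℝ)).congr_of_eventuallyEq ?_
    filter_upwards [hIo.mem_nhds hx] with y hy using hzero y hy
  exact (hG x hx).unique hc

theorem hasDerivAt_im {f : ℝ → ℂ} {f' : ℂ} {x : ℝ} (h : HasDerivAt f f' x) :
    HasDerivAt (fun y => (f y).im) f'.im x :=
  Complex.imCLM.hasFDerivAt.comp_hasDerivAt x h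

theorem hasDerivAt_conj {f : ℝ → ℂ} {f' : ℂ} {x : ℝ} (h : HasDerivAt f f' x) :
    HasDerivAt (fun y => conj (f y)) (conj f') x :=
  Complex.conjCLE.toContinuousLinearMap.hasFDerivAt.comp_hasDerivAt x h

/-- Vanishing of the solutions of the radial equation after Whiting's transformation. -/
theorem eq_zero_of_transformed_radial_equation {d b a B : ℝ} {m : ℤ} {ω lam k μ : ℂ}
    (hd : 0 < d) (hb : 0 ≤ b) (hω : 0 < ω.im) (hlam : (conj ω * lam).im ≤ 0)
    (hk : k = ω * (b ^ 2 + a ^ 2) - a * m)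
    (hμ : μ = 2 * a * m * ω - a ^ 2 * ω ^ 2 - lam) {f f₁ f₂ : ℝ → ℂ}
    (hf : ∀ s, d < s → HasDerivAt f (f₁ s) s) (hf₁ : ∀ s, d < s → HasDerivAt f₁ (f₂ s) s)
    (hode : ∀ s : ℝ, d < s → (s : ℂ) * (s - d) * f₂ s
      + (2 * s - d - 2 * Complex.I * ω * (s * (s + 2 * b))) * f₁ s
      + (-(Complex.I * ω * (2 * s + 2 * b)) + μ + 4 * ω * k * s / d) * f s = 0)
    (hB : ∀ s, d < s → ‖f s‖ ≤ B * Real.exp (-(2 * ω.im * s)))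
    (hB₁ : ∀ s, d < s → ‖f₁ s‖ ≤ B * Real.exp (-(2 * ω.im * s))) {s : ℝ} (hs : d < s) :
    f s = 0 := by
  set ν := ω.im with hν
  have hB0 : 0 ≤ B :=
    nonneg_of_mul_nonneg_left ((norm_nonneg _).trans (hB s hs)) (Real.exp_pos _)
  -- The exponent is the residue at s = d of 2ν(s + 2b)/(s - d), which is to be the logarithmic
  -- derivative of the weight `h`.
  set e := 2 * ν * (d + 2 * b) with he
  have he0 : 0 < e := by positivity
  set h : ℝ → ℝ := fun s => Real.exp (2 * ν * s) * (s - d) ^ e with hh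
  have hhpos : ∀ s, d < s → 0 < h s := fun s hs =>
    mul_pos (Real.exp_pos _) (Real.rpow_pos_of_pos (sub_pos.2 hs) _)
  have hh' : ∀ s, d < s → HasDerivAt h (h s * (2 * ν * (s + 2 * b) / (s - d))) s := by
    intro s hs
    have hsd : 0 < s - d := sub_pos.2 hs
    have e1 : HasDerivAt (fun s => Real.exp (2 * ν * s)) (Real.exp (2 * ν * s) * (2 * ν)) s := by
      simpa using ((hasDerivAt_id s).const_mul (2 * ν)).exp
    have e2 : HasDerivAt (fun s => (s - d) ^ e) (1 * e * (s - d) ^ (e - 1)) s :=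
      ((hasDerivAt_id s).sub_const d).rpow_const (Or.inl hsd.ne')
    refine (e1.mul e2).congr_deriv ?_
    rw [Real.rpow_sub_one hsd.ne', hh, he]
    field_simp
    ring
  -- Subtracting the multiple of `f` halves the first-order term of the equation. In the derivative
  -- of Im(ω̄T f̄) the cross terms then combine to a real multiple of T f̄, namely -2ν(s + 2b)/(s -
  -- d), which the weight `h` cancels.
  set T : ℝ → ℂ := fun s => (s : ℂ) * (s - d) * f₁ s - Complex.I * ω * (s * (s + 2 * b)) * f s
    with hT
  have hT' : ∀ s, d < s → HasDerivAt T (Complex.I * ω * (s * (s + 2 * b)) * f₁ s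
      - (μ + 4 * ω * k * s / d) * f s) s := by
    intro s hs
    have i0 : HasDerivAt (fun s : ℝ => (s : ℂ)) 1 s := Complex.ofRealCLM.hasDerivAt
    have e1 := ((i0.mul (i0.sub_const (d : ℂ))).mul (hf₁ s hs))
    have e2 := (((i0.mul (i0.add_const (2 * b : ℂ))).const_mul (Complex.I * ω)).mul (hf s hs))
    refine (e1.sub e2).congr_deriv ?_
    simp only [Pi.mul_apply]
    linear_combination hode s hs
  set G : ℝ → ℝ := fun s => h s * (conj ω * (T s * conj (f s))).im with hGdef
  -- Here `am` has disappeared: ω̄ωk and ω̄μ contain it only with real coefficients.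
  set V : ℝ → ℝ := fun s => Complex.normSq ω * ν *
    (s * (s + 2 * b) ^ 2 / (s - d) + 4 * s * (b ^ 2 + a ^ 2) / d - a ^ 2)
      - (conj ω * lam).im with hV
  set G' : ℝ → ℝ := fun s => -(h s * (ν * Complex.normSq (T s) / (s * (s - d))
    + V s * Complex.normSq (f s))) with hG'
  have hVpos : ∀ s, d < s → 0 < V s := by
    intro s hs
    have hs0 : 0 < s := hd.trans hs
    have hsd : 0 < s - d := sub_pos.2 hs
    have hn : 0 < Complex.normSq ω := Complex.normSq_pos.2 (by rintro rfl; simp [hν] at hω)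
    have h1 : 0 < s * (s + 2 * b) ^ 2 / (s - d) := by positivity
    -- Since s > d, the factor 4s/d exceeds 4, which absorbs the only negative term.
    have h2 : a ^ 2 ≤ 4 * s * (b ^ 2 + a ^ 2) / d := by
      rw [le_div_iff₀ hd]
      nlinarith [sq_nonneg a, sq_nonneg b, mul_nonneg hs0.le (sq_nonneg b),
        mul_nonneg hsd.le (sq_nonneg a)]
    have := mul_pos (mul_pos hn hω)
      (show 0 < s * (s + 2 * b) ^ 2 / (s - d) + 4 * s * (b ^ 2 + a ^ 2) / d - a ^ 2 by linarith)
    simp only [hV]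
    linarith
  have hGd : ∀ s ∈ Ioi d, HasDerivAt G (G' s) s := by
    intro s hs
    have hs' : d < s := hs
    have hs0 : s ≠ 0 := (hd.trans hs).ne'
    have hsd : s - d ≠ 0 := (sub_pos.2 hs').ne'
    have e1 := hasDerivAt_im (((hT' s hs).mul (hasDerivAt_conj (hf s hs))).const_mul (conj ω))
    refine ((hh' s hs).mul e1).congr_deriv ?_
    rw [hμ, hk, hG', hV, hT]
    simp only [Pi.mul_apply, Complex.normSq_apply, Complex.mul_im, Complex.mul_re, Complex.add_re,
      Complex.add_im, Complex.sub_re, Complex.sub_im, Complex.conj_re, Complex.conj_im,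
      Complex.I_re, Complex.I_im, Complex.ofReal_re, Complex.ofReal_im, pow_two,
      Complex.div_ofReal_re, Complex.div_ofReal_im, Complex.re_ofNat, Complex.im_ofNat,
      Complex.intCast_re, Complex.intCast_im]
    generalize h s = H
    rw [← hν]
    field_simp
    ring
  have hGn : ∀ s ∈ Ioi d, G' s ≤ 0 := by
    intro s hs
    have hs' : d < s := hs
    have hs0 : 0 < s := hd.trans hs
    have hsd : 0 < s - d := sub_pos.2 hs'
    have := hhpos s hs
    have := hVpos s hs
    have := Complex.normSq_nonneg (f s)
    have := Complex.normSq_nonneg (T s)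
    simp only [hG', Left.neg_nonpos_iff]
    positivity
  set A := ‖ω‖ * ((1 + ‖ω‖ * (1 + 2 * b / d)) * B * B) with hA
  -- The weight grows like exp(2νs), while the product of the two decaying factors is of order
  -- exp(-4νs); the net factor exp(-2νs) controls infinity and the positive power of s - d controls
  -- the other end.
  have hGb : ∀ s, d < s → ‖G s‖ ≤ A * (s ^ 2 * Real.exp (-(2 * ν * s)) * (s - d) ^ e) := by
    intro s hs
    have hs0 : 0 < s := hd.trans hs
    have hsd : 0 < s - d := sub_pos.2 hs
    have hTb : ‖T s‖ ≤ (1 + ‖ω‖ * (1 + 2 * b / d)) * B * (s ^ 2 * Real.exp (-(2 * ν * s))) := by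
      have n1 : ‖(s : ℂ)‖ = s := by simp [abs_of_pos hs0]
      have n2 : ‖(s : ℂ) - d‖ ≤ s := by
        rw [← Complex.ofReal_sub, Complex.norm_real, Real.norm_of_nonneg hsd.le]
        linarith
      have n3 : ‖(s : ℂ) + 2 * b‖ ≤ s * (1 + 2 * b / d) := by
        have : ((s : ℂ) + 2 * b) = ((s + 2 * b : ℝ) : ℂ) := by push_cast; ring
        rw [this, Complex.norm_real, Real.norm_of_nonneg (by positivity), mul_add, mul_one]
        have : 2 * b ≤ s * (2 * b / d) := by
          rw [mul_div_assoc', le_div_iff₀ hd]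
          nlinarith
        linarith
      calc ‖T s‖ ≤ ‖(s : ℂ) * (s - d) * f₁ s‖ + ‖Complex.I * ω * (s * (s + 2 * b)) * f s‖ :=
            norm_sub_le _ _
        _ = s * ‖(s : ℂ) - d‖ * ‖f₁ s‖ + ‖ω‖ * (s * ‖(s : ℂ) + 2 * b‖) * ‖f s‖ := by
            simp only [norm_mul, n1, Complex.norm_I, one_mul]
        _ ≤ s * s * (B * Real.exp (-(2 * ν * s)))
            + ‖ω‖ * (s * (s * (1 + 2 * b / d))) * (B * Real.exp (-(2 * ν * s))) := by
            gcongr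
            · exact hB₁ s hs
            · exact hB s hs
        _ = _ := by ring
    calc ‖G s‖ = h s * |(conj ω * (T s * conj (f s))).im| := by
          rw [hGdef, norm_mul, Real.norm_of_nonneg (hhpos s hs).le, Real.norm_eq_abs]
      _ ≤ h s * (‖ω‖ * (‖T s‖ * ‖f s‖)) := by
          have := (hhpos s hs).le
          gcongr
          refine (Complex.abs_im_le_norm _).trans_eq ?_
          simp only [norm_mul, RCLike.norm_conj]
      _ ≤ h s * (‖ω‖ * ((1 + ‖ω‖ * (1 + 2 * b / d)) * B * (s ^ 2 * Real.exp (-(2 * ν * s))) *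
            (B * Real.exp (-(2 * ν * s))))) := by
          have := (hhpos s hs).le
          gcongr
          exact hB s hs
      _ = A * (s ^ 2 * Real.exp (-(2 * ν * s)) * (s - d) ^ e) *
            (Real.exp (2 * ν * s) * Real.exp (-(2 * ν * s))) := by
          rw [hh, hA]; ring
      _ = _ := by rw [← Real.exp_add]; simp
  have ht₁ : Tendsto G (𝓝[>] d) (𝓝 0) := by
    have hc : ContinuousAt
        (fun s : ℝ => A * (s ^ 2 * Real.exp (-(2 * ν * s)) * (s - d) ^ e)) d := by
      refine ContinuousAt.mul (by fun_prop) (ContinuousAt.mul (by fun_prop) ?_)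
      exact ContinuousAt.rpow_const (by fun_prop) (Or.inr he0.le)
    have hc' := hc.tendsto
    simp only [sub_self, Real.zero_rpow he0.ne', mul_zero] at hc'
    refine squeeze_zero_norm' ?_ (hc'.mono_left nhdsWithin_le_nhds)
    filter_upwards [self_mem_nhdsWithin] with s hs using hGb s hs
  have ht₂ : Tendsto G atTop (𝓝 0) := by
    have h1 := (tendsto_rpow_mul_exp_neg_mul_atTop_nhds_zero (2 + e) (2 * ν)
      (by positivity)).const_mul A
    rw [mul_zero] at h1
    refine squeeze_zero_norm' ?_ h1
    filter_upwards [eventually_gt_atTop d] with s hs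
    have hs0 : 0 < s := hd.trans hs
    refine (hGb s hs).trans ?_
    have : 0 ≤ A := by positivity
    have h2 : (s - d) ^ e ≤ s ^ e :=
      Real.rpow_le_rpow (sub_pos.2 hs).le (by linarith) he0.le
    rw [Real.rpow_add hs0, Real.rpow_two, neg_mul]
    calc A * (s ^ 2 * Real.exp (-(2 * ν * s)) * (s - d) ^ e)
        ≤ A * (s ^ 2 * Real.exp (-(2 * ν * s)) * s ^ e) := by gcongr
      _ = _ := by ring
  have key := deriv_eq_zero_of_nonpos_of_tendsto_zero (convex_Ioi d) isOpen_Ioi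
    (l₁ := 𝓝[>] d) (l₂ := atTop)
    (fun x hx => by
      filter_upwards [Ioo_mem_nhdsGT (show d < x from hx)] with y hy using ⟨hy.1, hy.2.le⟩)
    (fun x hx => by
      filter_upwards [eventually_gt_atTop d, eventually_ge_atTop x] with y h1 h2 using ⟨h1, h2⟩)
    hGd hGn ht₁ ht₂ (show s ∈ Ioi d from hs)
  have hs0 : 0 < s := hd.trans hs
  have hsd : 0 < s - d := sub_pos.2 hs
  have p1 : 0 ≤ ν * Complex.normSq (T s) / (s * (s - d)) := by
    have := Complex.normSq_nonneg (T s)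
    positivity
  have p2 := hVpos s hs
  have p3 := hhpos s hs
  by_contra hne
  have p4 := Complex.normSq_pos.2 hne
  have : 0 < h s * (ν * Complex.normSq (T s) / (s * (s - d)) + V s * Complex.normSq (f s)) := by
    positivity
  simp only [hG'] at key
  linarith

/-! ### Whiting's transformation of the confluent Heun equation. -/

/-- The second-order equation `Δ g'' + (Δ' + 2iK) g' + (iK' + μ) g = 0` on `(d, ∞)`, where
`Δ = y (y - d)` and `K = ω y² + 2 b ω y + k`, as a system for `g` and `q = Δ g' + 2iK g`, with
vanishing data at `y = d` and a bound of exponential type `κ`. -/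
structure IsRegularConfluentHeun (d b : ℝ) (ω k μ : ℂ) (κ C : ℝ) (g q : ℝ → ℂ) : Prop where
  hasDerivAt_fst : ∀ y : ℝ, d < y → HasDerivAt g
    ((q y - 2 * Complex.I * (ω * y ^ 2 + 2 * b * ω * y + k) * g y) / (y * (y - d))) y
  hasDerivAt_snd : ∀ y : ℝ, d < y → HasDerivAt q
    ((Complex.I * (2 * ω * y + 2 * b * ω) - μ) * g y) y
  tendsto_fst : Tendsto g (𝓝[>] d) (𝓝 0)
  tendsto_snd : Tendsto q (𝓝[>] d) (𝓝 0)
  norm_fst_le : ∀ y, d < y → ‖g y‖ ≤ C * Real.exp (κ * y)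
  norm_snd_le : ∀ y, d < y → ‖q y‖ ≤ C * Real.exp (κ * y)

namespace IsRegularConfluentHeun

variable {d b : ℝ} {ω k μ : ℂ} {κ C : ℝ} {g q : ℝ → ℂ}

theorem continuousOn_fst (h : IsRegularConfluentHeun d b ω k μ κ C g q) :
    ContinuousOn g (Ioi d) :=
  fun y hy => (h.hasDerivAt_fst y hy).continuousAt.continuousWithinAt

theorem laplaceMoment_eq (h : IsRegularConfluentHeun d b ω k μ κ C g q) (hd : 0 < d) {p : ℂ}
    (hp : κ < p.re) :
    (p ^ 2 + 2 * Complex.I * ω * p) * laplaceMoment d g 2 p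
      + (-(d * p ^ 2) + 4 * Complex.I * b * ω * p - 2 * p - 2 * Complex.I * ω) *
          laplaceMoment d g 1 p
      + (2 * Complex.I * p * k + p * d - 2 * Complex.I * b * ω + μ) * laplaceMoment d g 0 p
      = 0 := by
  -- This is the boundary expression of two integrations by parts. In its derivative the terms in
  -- `q` cancel, leaving only moments of `g`.
  set E : ℝ → ℂ := fun y => Complex.exp (-p * y) * (q y + p * (y * (y - d)) * g y) with hE
  set E' : ℝ → ℂ := fun y =>
    -((p ^ 2 + 2 * Complex.I * ω * p) * ((y : ℂ) ^ 2 * Complex.exp (-p * y) * g y)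
      + (-(d * p ^ 2) + 4 * Complex.I * b * ω * p - 2 * p - 2 * Complex.I * ω) *
          ((y : ℂ) ^ 1 * Complex.exp (-p * y) * g y)
      + (2 * Complex.I * p * k + p * d - 2 * Complex.I * b * ω + μ) *
          ((y : ℂ) ^ 0 * Complex.exp (-p * y) * g y)) with hE'
  have hi : ∀ j, IntegrableOn (fun y : ℝ => (y : ℂ) ^ j * Complex.exp (-p * y) * g y) (Ioi d) :=
    fun j => integrableOn_laplace hd.le h.continuousOn_fst h.norm_fst_le j hp
  have i2 := (hi 2).const_mul (p ^ 2 + 2 * Complex.I * ω * p)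
  have i1 := (hi 1).const_mul
    (-(d * p ^ 2) + 4 * Complex.I * b * ω * p - 2 * p - 2 * Complex.I * ω)
  have i0 := (hi 0).const_mul (2 * Complex.I * p * k + p * d - 2 * Complex.I * b * ω + μ)
  have hint : IntegrableOn E' (Ioi d) := ((i2.add i1).add i0).neg
  have hval : ∫ y in Ioi d, E' y = 0 := by
    -- The values of `g` and `q` at `d` itself are unconstrained, so `E` is replaced there by its
    -- limit 0.
    have hder : ∀ y ∈ Ioi d, HasDerivAt (Function.update E d 0) (E' y) y := by
      intro y hy
      have hy' : d < y := hy
      have hy0 : (y : ℂ) ≠ 0 := Complex.ofReal_ne_zero.2 (hd.trans hy').ne'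
      have hyd : (y : ℂ) - d ≠ 0 := by
        rw [← Complex.ofReal_sub]
        exact Complex.ofReal_ne_zero.2 (sub_pos.2 hy').ne'
      have c0 : HasDerivAt (fun s : ℝ => (s : ℂ)) 1 y := Complex.ofRealCLM.hasDerivAt
      have e1 := (c0.const_mul (-p)).cexp
      have e2 := ((c0.mul (c0.sub_const (d : ℂ))).const_mul p).mul (h.hasDerivAt_fst y hy)
      have e3 := e1.mul ((h.hasDerivAt_snd y hy).add e2)
      have e4 : HasDerivAt E (E' y) y := by
        refine e3.congr_deriv ?_
        simp only [hE', Pi.mul_apply, Pi.add_apply]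
        field_simp
        ring
      refine e4.congr_of_eventuallyEq ?_
      filter_upwards [Ioi_mem_nhds hy'] with z hz
      rw [Function.update_of_ne (ne_of_gt hz)]
    have hcont : ContinuousWithinAt (Function.update E d 0) (Ici d) d := by
      rw [continuousWithinAt_update_same, Ici_sdiff_left]
      have a1 : Tendsto (fun y : ℝ => Complex.exp (-p * y)) (𝓝[>] d) (𝓝 (Complex.exp (-p * d))) :=
        ((by fun_prop : Continuous fun y : ℝ => Complex.exp (-p * y)).tendsto d).mono_left
          nhdsWithin_le_nhds
      have a2 : Tendsto (fun y : ℝ => p * ((y : ℂ) * (y - d))) (𝓝[>] d)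
          (𝓝 (p * ((d : ℂ) * (d - d)))) :=
        ((by fun_prop : Continuous fun y : ℝ => p * ((y : ℂ) * (y - d))).tendsto d).mono_left
          nhdsWithin_le_nhds
      simpa [E] using a1.mul (h.tendsto_snd.add (a2.mul h.tendsto_fst))
    have htop : Tendsto (Function.update E d 0) atTop (𝓝 0) := by
      have hC : 0 ≤ C := nonneg_of_mul_nonneg_left
        ((norm_nonneg _).trans (h.norm_fst_le (d + 1) (by linarith))) (Real.exp_pos _)
      have t0 := tendsto_rpow_mul_exp_neg_mul_atTop_nhds_zero 0 (p.re - κ) (sub_pos.2 hp)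
      have t2 := tendsto_rpow_mul_exp_neg_mul_atTop_nhds_zero 2 (p.re - κ) (sub_pos.2 hp)
      have t := ((t0.add (t2.const_mul ‖p‖)).const_mul C)
      simp only [mul_zero, add_zero] at t
      refine squeeze_zero_norm' ?_ t
      filter_upwards [eventually_gt_atTop d] with y hy
      have hy0 : 0 < y := hd.trans hy
      rw [Function.update_of_ne (ne_of_gt hy), Real.rpow_zero, Real.rpow_two, hE]
      have n1 : ‖(y : ℂ)‖ = y := by simp [abs_of_pos hy0]
      have n2 : ‖(y : ℂ) - d‖ ≤ y := by
        rw [← Complex.ofReal_sub, Complex.norm_real, Real.norm_of_nonneg (by linarith)]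
        linarith
      have n3 : ‖Complex.exp (-p * y)‖ = Real.exp (-p.re * y) := by
        rw [Complex.norm_exp]; simp
      have n4 : Real.exp (-(p.re - κ) * y) = Real.exp (-p.re * y) * Real.exp (κ * y) := by
        rw [← Real.exp_add]; ring_nf
      rw [norm_mul, n3, n4]
      calc Real.exp (-p.re * y) * ‖q y + p * (y * (y - d)) * g y‖
          ≤ Real.exp (-p.re * y) * (‖q y‖ + ‖p‖ * (y * ‖(y : ℂ) - d‖) * ‖g y‖) := by
            gcongr
            refine (norm_add_le _ _).trans_eq ?_
            simp only [norm_mul, n1]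
        _ ≤ Real.exp (-p.re * y) * (C * Real.exp (κ * y)
              + ‖p‖ * (y * y) * (C * Real.exp (κ * y))) := by
            gcongr
            · exact h.norm_snd_le y hy
            · exact h.norm_fst_le y hy
        _ = _ := by ring
    rw [integral_Ioi_of_hasDerivAt_of_tendsto hcont hder hint htop, Function.update_self, sub_zero]
  simp only [hE'] at hval
  have hsum := (integral_add (i2.add i1) i0).trans (congrArg (· + _) (integral_add i2 i1))
  simp only [integral_const_mul] at hsum
  rw [integral_neg, neg_eq_zero] at hval
  exact hsum.symm.trans hval

/-- Mode stability for the radial equation, via Whiting's integral transformation. -/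
theorem eq_zero (h : IsRegularConfluentHeun d b ω k μ κ C g q) (hd : 0 < d) (hb : 0 ≤ b)
    (hω : 0 < ω.im) (hκ : κ < 2 * ω.im) {a : ℝ} {m : ℤ} {lam : ℂ}
    (hlam : (conj ω * lam).im ≤ 0) (hk : k = ω * (b ^ 2 + a ^ 2) - a * m)
    (hμ : μ = 2 * a * m * ω - a ^ 2 * ω ^ 2 - lam) {y : ℝ} (hy : d < y) : g y = 0 := by
  -- The equation in p is singular at p = 0 and p = -2iω; this scaling moves the singular points to
  -- s = 0 and s = d. Moreover Re(cs) = 2 Im ω s/d > κ for s ≥ d, so the transform converges up to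
  -- and including s = d.
  set c : ℂ := -2 * Complex.I * ω / d with hc
  have hd' : (d : ℂ) ≠ 0 := Complex.ofReal_ne_zero.2 hd.ne'
  have hcd : c.re * d = 2 * ω.im := by
    rw [hc, Complex.div_ofReal_re, div_mul_cancel₀ _ hd.ne']
    simp
  have hcre : 0 < c.re := by
    have : 0 < c.re * d := by rw [hcd]; positivity
    exact pos_of_mul_pos_left this hd.le
  have hre : ∀ s : ℝ, (c * s).re = c.re * s := fun s => Complex.re_mul_ofReal c s
  have hκs : ∀ s : ℝ, d < s → κ < (c * s).re := by
    intro s hs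
    rw [hre]
    nlinarith
  refine eq_zero_of_laplaceMoment_eq_zero_on_ray hd.le h.continuousOn_fst h.norm_fst_le hcre
    (by rwa [hcd]) (fun s hs => ?_) hy
  have hder : ∀ j, ∀ s : ℝ, d < s → HasDerivAt (fun s : ℝ => laplaceMoment d g j (c * s))
      (-c * laplaceMoment d g (j + 1) (c * s)) s := by
    intro j s hs
    have e1 := hasDerivAt_laplaceMoment hd.le h.continuousOn_fst h.norm_fst_le j (hκs s hs)
    have e2 : HasDerivAt (fun s : ℝ => c * (s : ℂ)) (c * 1) s :=
      (Complex.ofRealCLM.hasDerivAt (x := s)).const_mul c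
    refine (e1.comp s e2).congr_deriv ?_
    ring
  obtain ⟨B₀, hB₀⟩ := norm_laplaceMoment_le hd.le h.norm_fst_le 0 hκ
  obtain ⟨B₁, hB₁⟩ := norm_laplaceMoment_le hd.le h.norm_fst_le 1 hκ
  have hbd : ∀ s : ℝ, d < s → 2 * ω.im ≤ (c * s).re ∧ (c * s).re * d = 2 * ω.im * s := by
    intro s hs
    rw [hre]
    exact ⟨by nlinarith, by rw [← hcd]; ring⟩
  refine eq_zero_of_transformed_radial_equation (B := max B₀ (‖c‖ * B₁)) (a := a) (m := m) hd hb hω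
    hlam hk hμ (f := fun s : ℝ => laplaceMoment d g 0 (c * s))
    (f₁ := fun s : ℝ => -c * laplaceMoment d g 1 (c * s))
    (f₂ := fun s : ℝ => -c * (-c * laplaceMoment d g 2 (c * s)))
    (hder 0) (fun s hs => (hder 1 s hs).const_mul (-c)) (fun s hs => ?_) (fun s hs => ?_)
    (fun s hs => ?_) hs
  · have key := h.laplaceMoment_eq hd (hκs s hs)
    have hcdω : c * d = -2 * Complex.I * ω := by rw [hc]; field_simp
    have hω' : ω = Complex.I * c * d / 2 := by
      linear_combination (-Complex.I / 2) * hcdω + ω * Complex.I_sq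
    have hcI : 4 * ω * k * s / d = 2 * Complex.I * c * s * k := by
      rw [hω']; field_simp; ring
    rw [hcI]
    have h2 : 2 * Complex.I * ω = -(c * d) := by rw [hcdω]; ring
    clear_value c
    linear_combination key + (-(c * s) * laplaceMoment d g 2 (c * s)
      + (1 + c * s ^ 2) * laplaceMoment d g 1 (c * s) - s * laplaceMoment d g 0 (c * s)) * h2
  · obtain ⟨h1, h2⟩ := hbd s hs
    refine (hB₀ _ h1).trans ?_
    rw [h2]
    gcongr
    exact le_max_left _ _
  · obtain ⟨h1, h2⟩ := hbd s hs
    rw [norm_mul, norm_neg]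
    refine (mul_le_mul_of_nonneg_left (hB₁ _ h1) (norm_nonneg c)).trans ?_
    rw [h2, ← mul_assoc]
    gcongr
    exact le_max_right _ _

end IsRegularConfluentHeun

/-! ### The angular equation. -/

theorem contMDiff_sphPoint :
    ContMDiff 𝓘(ℝ, ℝ) (𝓡 2) ((⊤ : ℕ∞) : WithTop ℕ∞) (fun θ : ℝ => sphPoint θ 0) := by
  have h : ContDiff ℝ ((⊤ : ℕ∞) : WithTop ℕ∞) (fun θ : ℝ =>
      (!₂[Real.sin θ * Real.cos 0, Real.sin θ * Real.sin 0, Real.cos θ] :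
        EuclideanSpace ℝ (Fin 3))) := by
    rw [contDiff_euclidean]
    intro i
    fin_cases i
    · exact Real.contDiff_sin.mul contDiff_const
    · exact Real.contDiff_sin.mul contDiff_const
    · exact Real.contDiff_cos
  exact h.contMDiff.codRestrict_sphere fun θ => (sphPoint θ 0).2

/-- The sign of the angular eigenvalues for frequencies in the upper half-plane. -/
theorem IsAngularEigenfunction.im_conj_mul_nonpos {a : ℝ} {ω : ℂ} {m : ℤ} {lam : ℂ} {S : ℝ → ℂ}
    (h : IsAngularEigenfunction a ω m lam S) (hω : 0 < ω.im) : (conj ω * lam).im ≤ 0 := by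
  obtain ⟨⟨θ₀, hθ₀, hS₀⟩, -, hode, Y, hY, hYS⟩ := h
  by_contra! hpos
  -- Restricting to the meridian φ = 0 removes the phase and extends `S` smoothly through the poles,
  -- where the factor sin θ makes the flux vanish.
  set Z : ℝ → ℂ := fun θ => Y (sphPoint θ 0) with hZ
  have hZc : ContDiff ℝ ((⊤ : ℕ∞) : WithTop ℕ∞) Z :=
    contMDiff_iff_contDiff.1 (hY.comp contMDiff_sphPoint)
  have hSZ : ∀ θ ∈ Ioo 0 Real.pi, S θ = Z θ := fun θ hθ => by
    have := hYS θ hθ 0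
    simpa using this.symm
  have hZ₁c : ContDiff ℝ ((⊤ : ℕ∞) : WithTop ℕ∞) (deriv Z) :=
    (contDiff_infty_iff_deriv.1 hZc).2
  have hZd : ∀ θ, HasDerivAt Z (deriv Z θ) θ := fun θ =>
    ((contDiff_infty_iff_deriv.1 hZc).1 θ).hasDerivAt
  have hZd₁ : ∀ θ, HasDerivAt (deriv Z) (deriv (deriv Z) θ) θ := fun θ =>
    ((contDiff_infty_iff_deriv.1 hZ₁c).1 θ).hasDerivAt
  have hdS : ∀ θ ∈ Ioo 0 Real.pi, deriv S θ = deriv Z θ := fun θ hθ =>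
    EventuallyEq.deriv_eq (by
      filter_upwards [isOpen_Ioo.mem_nhds hθ] with x hx using hSZ x hx)
  set T : ℝ → ℂ := fun θ => (Real.sin θ : ℂ) * deriv Z θ with hT
  have hTd : ∀ θ, HasDerivAt T ((Real.cos θ : ℂ) * deriv Z θ
      + (Real.sin θ : ℂ) * deriv (deriv Z) θ) θ := fun θ =>
    (Real.hasDerivAt_sin θ).ofReal_comp.mul (hZd₁ θ)
  have hTode : ∀ θ ∈ Ioo 0 Real.pi, HasDerivAt T (Real.sin θ *
      (((m : ℂ) ^ 2 / (Real.sin θ : ℂ) ^ 2 - (a : ℂ) ^ 2 * ω ^ 2 * (Real.cos θ : ℂ) ^ 2 - lam)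
        * Z θ)) θ := by
    intro θ hθ
    have h1 : deriv (fun θ' : ℝ => (Real.sin θ' : ℂ) * deriv S θ') θ
        = (Real.cos θ : ℂ) * deriv Z θ + (Real.sin θ : ℂ) * deriv (deriv Z) θ := by
      rw [← (hTd θ).deriv]
      refine EventuallyEq.deriv_eq ?_
      filter_upwards [isOpen_Ioo.mem_nhds hθ] with x hx
      rw [hT, hdS x hx]
    have h2 := hode θ hθ
    rw [h1, hSZ θ hθ] at h2
    refine (hTd θ).congr_deriv ?_
    have hs : (Real.sin θ : ℂ) ≠ 0 :=
      Complex.ofReal_ne_zero.2 (Real.sin_pos_of_mem_Ioo hθ).ne'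
    have h3 : (Real.sin θ : ℂ) * ((1 / Real.sin θ : ℝ) : ℂ) = 1 := by
      rw [one_div, Complex.ofReal_inv, mul_inv_cancel₀ hs]
    linear_combination (Real.sin θ : ℂ) * h2
      - ((Real.cos θ : ℂ) * deriv Z θ + (Real.sin θ : ℂ) * deriv (deriv Z) θ) * h3
  set G : ℝ → ℝ := fun θ => (conj ω * (T θ * conj (Z θ))).im with hG
  set V : ℝ → ℝ := fun θ => ω.im * (m : ℝ) ^ 2 / Real.sin θ ^ 2
    + a ^ 2 * Complex.normSq ω * ω.im * Real.cos θ ^ 2 + (conj ω * lam).im with hV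
  set G' : ℝ → ℝ := fun θ => -(Real.sin θ * (ω.im * Complex.normSq (deriv Z θ)
    + V θ * Complex.normSq (Z θ))) with hG'
  have hVpos : ∀ θ, 0 < V θ := fun θ => by
    have := Complex.normSq_nonneg ω
    positivity
  have hGd : ∀ θ ∈ Ioo 0 Real.pi, HasDerivAt G (G' θ) θ := by
    intro θ hθ
    have hs : Real.sin θ ≠ 0 := (Real.sin_pos_of_mem_Ioo hθ).ne'
    have e := hasDerivAt_im (((hTode θ hθ).mul (hasDerivAt_conj (hZd θ))).const_mul (conj ω))
    refine e.congr_deriv ?_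
    have h1 : (m : ℂ) ^ 2 / (Real.sin θ : ℂ) ^ 2 = (((m : ℝ) ^ 2 / Real.sin θ ^ 2 : ℝ) : ℂ) := by
      push_cast; rfl
    have h2 : ω.im * (m : ℝ) ^ 2 / Real.sin θ ^ 2 = ω.im * ((m : ℝ) ^ 2 / Real.sin θ ^ 2) := by
      ring
    rw [h1, hG', hV, hT]
    dsimp only
    rw [h2]
    generalize (m : ℝ) ^ 2 / Real.sin θ ^ 2 = N
    generalize deriv Z θ = z₁
    generalize Z θ = z
    generalize Real.sin θ = s
    generalize Real.cos θ = c
    simp only [Complex.normSq_apply, Complex.mul_im, Complex.mul_re, Complex.add_re,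
      Complex.add_im, Complex.sub_re, Complex.sub_im, Complex.conj_re, Complex.conj_im,
      Complex.ofReal_re, Complex.ofReal_im, pow_two]
    ring
  have hGn : ∀ θ ∈ Ioo 0 Real.pi, G' θ ≤ 0 := by
    intro θ hθ
    have := Real.sin_pos_of_mem_Ioo hθ
    have := hVpos θ
    have := Complex.normSq_nonneg (Z θ)
    have := Complex.normSq_nonneg (deriv Z θ)
    simp only [hG', Left.neg_nonpos_iff]
    positivity
  have hGc : Continuous G := by
    have := hZc.continuous
    have := hZ₁c.continuous
    fun_prop
  have ht₁ : Tendsto G (𝓝[>] 0) (𝓝 0) := by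
    have h0 := hGc.tendsto 0
    simp only [hG, hT, Real.sin_zero, Complex.ofReal_zero, zero_mul, mul_zero,
      Complex.zero_im] at h0
    exact h0.mono_left nhdsWithin_le_nhds
  have ht₂ : Tendsto G (𝓝[<] Real.pi) (𝓝 0) := by
    have h0 := hGc.tendsto Real.pi
    simp only [hG, hT, Real.sin_pi, Complex.ofReal_zero, zero_mul, mul_zero,
      Complex.zero_im] at h0
    exact h0.mono_left nhdsWithin_le_nhds
  have key := deriv_eq_zero_of_nonpos_of_tendsto_zero (convex_Ioo 0 Real.pi) isOpen_Ioo
    (l₁ := 𝓝[>] 0) (l₂ := 𝓝[<] Real.pi)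
    (fun x hx => by
      filter_upwards [Ioo_mem_nhdsGT hx.1] with y hy using ⟨⟨hy.1, hy.2.trans hx.2⟩, hy.2.le⟩)
    (fun x hx => by
      filter_upwards [Ioo_mem_nhdsLT hx.2] with y hy using ⟨⟨hx.1.trans hy.1, hy.2⟩, hy.1.le⟩)
    hGd hGn ht₁ ht₂ hθ₀
  rw [hSZ θ₀ hθ₀] at hS₀
  have p1 := Real.sin_pos_of_mem_Ioo hθ₀
  have p2 := hVpos θ₀
  have p3 := Complex.normSq_pos.2 hS₀
  have p4 := Complex.normSq_nonneg (deriv Z θ₀)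
  have : 0 < Real.sin θ₀ * (ω.im * Complex.normSq (deriv Z θ₀) + V θ₀ * Complex.normSq (Z θ₀)) := by
    positivity
  simp only [hG'] at key
  linarith

/-! ### Growth bounds and the weighted radial function. -/

theorem exists_norm_le_exp {d κ : ℝ} {f : ℝ → ℂ} (hf : ContinuousOn f (Ioi d))
    (h0 : Tendsto f (𝓝[>] d) (𝓝 0)) (hO : f =O[atTop] fun y => Real.exp (κ * y)) :
    ∃ C, ∀ y, d < y → ‖f y‖ ≤ C * Real.exp (κ * y) := by
  obtain ⟨C₁, hC₁⟩ := hO.bound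
  obtain ⟨Y, hY⟩ := eventually_atTop.1 hC₁
  set F : ℝ → ℝ := fun y => ‖f y‖ * Real.exp (-κ * y) with hF
  have hFc : ContinuousOn (Function.update F d 0) (Ici d) := by
    intro y hy
    rcases eq_or_lt_of_le (show d ≤ y from hy) with rfl | hlt
    · rw [continuousWithinAt_update_same, Ici_sdiff_left]
      have e := ((by fun_prop : Continuous fun y : ℝ => Real.exp (-κ * y)).tendsto d).mono_left
        (nhdsWithin_le_nhds (s := Ioi d))
      simpa [F] using h0.norm.mul e
    · rw [continuousWithinAt_update_of_ne hlt.ne']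
      exact ((hf.continuousAt (Ioi_mem_nhds hlt)).norm.mul (by fun_prop)).continuousWithinAt
  obtain ⟨C₂, hC₂⟩ := (isCompact_Icc (a := d) (b := Y)).exists_bound_of_continuousOn
    (hFc.mono Icc_subset_Ici_self)
  refine ⟨max C₁ C₂, fun y hy => ?_⟩
  rcases le_total Y y with h | h
  · refine (hY y h).trans ?_
    rw [Real.norm_of_nonneg (Real.exp_pos _).le]
    gcongr
    exact le_max_left _ _
  · have h1 := (le_abs_self _).trans (hC₂ y ⟨hy.le, h⟩)
    rw [Function.update_of_ne hy.ne', hF] at h1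
    have h2 : ‖f y‖ = ‖f y‖ * Real.exp (-κ * y) * Real.exp (κ * y) := by
      rw [mul_assoc, ← Real.exp_add]
      simp
    rw [h2]
    gcongr
    exact h1.trans (le_max_right _ _)

/-- The asymptotic condition on R says nothing about R', so the flux ΔR' is bounded by integrating
its derivative; doubling the rate absorbs the length of the interval. -/
theorem isBigO_exp_of_isBigO_deriv {P P' : ℝ → ℂ} {δ : ℝ} (hδ : 0 < δ)
    (hP : ∀ᶠ y in atTop, HasDerivAt P (P' y) y)
    (hO : P' =O[atTop] fun y => Real.exp (δ * y)) :
    P =O[atTop] fun y => Real.exp (2 * δ * y) := by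
  obtain ⟨C, hC⟩ := hO.bound
  obtain ⟨Y, hY⟩ := eventually_atTop.1 (hP.and hC)
  have hC0 : 0 ≤ C := by
    have h := (norm_nonneg _).trans (hY Y le_rfl).2
    rw [Real.norm_of_nonneg (Real.exp_pos _).le] at h
    exact nonneg_of_mul_nonneg_left h (Real.exp_pos _)
  have h1 : ∀ᶠ y in atTop, ‖P y‖ ≤ ‖P Y‖ + C * Real.exp (δ * y) * (y - Y) := by
    filter_upwards [eventually_ge_atTop Y] with y hy
    have key := norm_image_sub_le_of_norm_deriv_le_segment' (f := P) (f' := P') (a := Y) (b := y)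
      (C := C * Real.exp (δ * y)) (fun x hx => (hY x hx.1).1.hasDerivWithinAt) (fun x hx => by
        refine (hY x hx.1).2.trans ?_
        rw [Real.norm_of_nonneg (Real.exp_pos _).le]
        have := hx.2.le
        gcongr) y ⟨hy, le_rfl⟩
    linarith [norm_sub_norm_le (P y) (P Y)]
  have h2 : (fun y => ‖P Y‖ + C * Real.exp (δ * y) * (y - Y)) =O[atTop]
      fun y => Real.exp (2 * δ * y) := by
    have e0 : (fun _ : ℝ => (1 : ℝ)) =O[atTop] fun y => Real.exp (δ * y) :=
      (isLittleO_pow_exp_pos_mul_atTop (k := 0) hδ).isBigO.congr_left fun y => pow_zero y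
    have e1 : (fun y : ℝ => y) =O[atTop] fun y => Real.exp (δ * y) :=
      (isLittleO_pow_exp_pos_mul_atTop (k := 1) hδ).isBigO.congr_left fun y => pow_one y
    have e2 := (e0.const_mul_left ‖P Y‖).mul e0
    have e3 := ((isBigO_refl (fun y : ℝ => Real.exp (δ * y)) atTop).const_mul_left C).mul
      (e1.sub (e0.const_mul_left Y))
    refine (e2.add e3).congr (fun y => by ring) fun y => ?_
    rw [← Real.exp_add]
    ring_nf
  exact (IsBigO.of_bound 1 (by
    filter_upwards [h1] with y hy
    rw [one_mul]
    exact hy.trans (le_abs_self _))).trans h2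

theorem isBigO_ofReal_pow_exp (n : ℕ) {δ : ℝ} (hδ : 0 < δ) :
    (fun y : ℝ => (y : ℂ) ^ n) =O[atTop] fun y => Real.exp (δ * y) := by
  refine IsBigO.of_norm_left ?_
  refine ((isLittleO_pow_exp_pos_mul_atTop (k := n) hδ).isBigO.norm_left).congr_left fun y => ?_
  simp

theorem isBigO_quadratic_exp (A B C : ℂ) {δ : ℝ} (hδ : 0 < δ) :
    (fun y : ℝ => A * (y : ℂ) ^ 2 + B * y + C) =O[atTop] fun y => Real.exp (δ * y) := by
  have h2 := (isBigO_ofReal_pow_exp 2 hδ).const_mul_left A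
  have h1 := (isBigO_ofReal_pow_exp 1 hδ).const_mul_left B
  have h0 := (isBigO_ofReal_pow_exp 0 hδ).const_mul_left C
  refine ((h2.add h1).add h0).congr_left fun y => ?_
  ring

/-- The weight that removes the exponents at both horizons and at infinity. -/
noncomputable def horizonWeight (d : ℝ) (ω η ξ : ℂ) (y : ℝ) : ℂ :=
  Complex.exp (-(Complex.I * ω * y) + η * Real.log y + ξ * Real.log (y - d))

theorem hasDerivAt_horizonWeight {d : ℝ} {ω η ξ : ℂ} (hd : 0 < d) {y : ℝ} (hy : d < y) :
    HasDerivAt (horizonWeight d ω η ξ)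
      ((-(Complex.I * ω) + η / y + ξ / (y - d)) * horizonWeight d ω η ξ y) y := by
  have c0 : HasDerivAt (fun s : ℝ => (s : ℂ)) 1 y := Complex.ofRealCLM.hasDerivAt
  have c1 := (Real.hasDerivAt_log (hd.trans hy).ne').ofReal_comp
  have c2 := (((hasDerivAt_id y).sub_const d).log (sub_pos.2 hy).ne').ofReal_comp
  have c3 := (((c0.const_mul (Complex.I * ω)).neg.add (c1.const_mul η)).add (c2.const_mul ξ)).cexp
  refine c3.congr_deriv ?_
  simp only [horizonWeight, Pi.add_apply, Pi.neg_apply, id]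
  push_cast
  ring

theorem isBigO_horizonWeight {d : ℝ} (hd : 0 < d) (ω η ξ : ℂ) (hξ : 0 ≤ ξ.re) {δ : ℝ}
    (hδ : 0 < δ) :
    horizonWeight d ω η ξ =O[atTop] fun y => Real.exp ((ω.im + δ) * y) := by
  refine IsBigO.of_bound 1 ?_
  have hA : 0 < |η.re| + ξ.re + 1 := by positivity
  have hl := Real.isLittleO_log_id_atTop.bound (div_pos hδ hA)
  filter_upwards [hl, eventually_gt_atTop d, eventually_ge_atTop 1] with y h1 h2 h3
  rw [one_mul, Real.norm_of_nonneg (Real.exp_pos _).le, horizonWeight, Complex.norm_exp]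
  have hlog : 0 ≤ Real.log y := Real.log_nonneg h3
  have hy : 0 < y := by linarith
  rw [id, Real.norm_of_nonneg hlog, Real.norm_of_nonneg hy.le, div_mul_eq_mul_div,
    le_div_iff₀ hA] at h1
  have h4 : Real.log (y - d) ≤ Real.log y := Real.log_le_log (sub_pos.2 h2) (by linarith)
  have h5 : ξ.re * Real.log (y - d) ≤ ξ.re * Real.log y := by gcongr
  have h6 : η.re * Real.log y ≤ |η.re| * Real.log y := by gcongr; exact le_abs_self _
  refine Real.exp_le_exp.2 ?_
  simp
  nlinarith

theorem tendsto_cexp_mul_log_sub {d : ℝ} {ξ : ℂ} (hξ : 0 < ξ.re) :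
    Tendsto (fun y : ℝ => Complex.exp (ξ * Real.log (y - d))) (𝓝[>] d) (𝓝 0) := by
  rw [Complex.tendsto_exp_nhds_zero_iff]
  have h1 : Tendsto (fun y : ℝ => y - d) (𝓝[>] d) (𝓝[>] 0) := by
    refine tendsto_nhdsWithin_iff.2 ⟨?_, ?_⟩
    · exact (((continuous_id.sub continuous_const).tendsto' d 0 (sub_self d))).mono_left
        nhdsWithin_le_nhds
    · filter_upwards [self_mem_nhdsWithin] with y hy using sub_pos.2 (show d < y from hy)
  have h2 := (Real.tendsto_log_nhdsGT_zero.comp h1).const_mul_atBot hξ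
  refine h2.congr fun y => ?_
  simp

/-- The weighted radial function and its flux. -/
theorem exists_isRegularConfluentHeun {d b a : ℝ} {m : ℤ} {ω k μ ξ : ℂ} (hd : 0 < d)
    (hb : 0 ≤ b) (hω : 0 < ω.im) (hk : k = ω * (b ^ 2 + a ^ 2) - a * m)
    (hξ : ξ = -(Complex.I * (ω * d ^ 2 + 2 * b * ω * d + k)) / d) {u P v : ℝ → ℂ}
    (hu : ∀ y : ℝ, d < y → HasDerivAt u (P y / (y * (y - d))) y)
    (hP : ∀ y : ℝ, d < y → HasDerivAt P
      (-(((ω * y ^ 2 + 2 * b * ω * y + k) ^ 2 / (y * (y - d)) + μ) * u y)) y)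
    (hv : ContDiffOn ℝ 1 v (Ici d))
    (huv : ∀ y : ℝ, d < y → u y = Complex.exp (ξ * Real.log (y - d)) * v y)
    (hbdd : u =O[atTop] fun _ => (1 : ℝ)) :
    ∃ κ C, κ < 2 * ω.im ∧ IsRegularConfluentHeun d b ω k μ κ C
      (fun y => horizonWeight d ω (Complex.I * k / d) ξ y * u y)
      (fun y => horizonWeight d ω (Complex.I * k / d) ξ y *
        (P y + Complex.I * (ω * y ^ 2 + 2 * b * ω * y + k) * u y)) := by
  set ν := ω.im with hν
  set η := Complex.I * k / d with hη
  set W := horizonWeight d ω η ξ with hW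
  set K : ℝ → ℂ := fun y => ω * y ^ 2 + 2 * b * ω * y + k with hK
  set g : ℝ → ℂ := fun y => W y * u y with hg
  set q : ℝ → ℂ := fun y => W y * (P y + Complex.I * K y * u y) with hq
  have hdC : (d : ℂ) ≠ 0 := Complex.ofReal_ne_zero.2 hd.ne'
  have hy0 : ∀ y : ℝ, d < y → (y : ℂ) ≠ 0 := fun y hy =>
    Complex.ofReal_ne_zero.2 (hd.trans hy).ne'
  have hyd : ∀ y : ℝ, d < y → (y : ℂ) - d ≠ 0 := fun y hy => by
    rw [← Complex.ofReal_sub]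
    exact Complex.ofReal_ne_zero.2 (sub_pos.2 hy).ne'
  have hWd : ∀ y : ℝ, d < y → HasDerivAt W (-(Complex.I * K y / (y * (y - d))) * W y) y := by
    intro y hy
    refine (hasDerivAt_horizonWeight hd hy).congr_deriv ?_
    have := hy0 y hy
    have := hyd y hy
    -- Partial fractions of -iK/Δ: the exponents `η` and `ξ` are its residues at y = 0 and y = d.
    have e : -(Complex.I * ω) + η / y + ξ / (y - d) = -(Complex.I * K y / (y * (y - d))) := by
      rw [hη, hξ, hK]
      field_simp
      ring
    rw [e]
  have hgd : ∀ y : ℝ, d < y → HasDerivAt g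
      ((q y - 2 * Complex.I * K y * g y) / (y * (y - d))) y := by
    intro y hy
    refine ((hWd y hy).mul (hu y hy)).congr_deriv ?_
    have := hy0 y hy
    have := hyd y hy
    simp only [hq, hg]
    field_simp
    ring
  have hKd : ∀ y : ℝ, HasDerivAt K (2 * ω * y + 2 * b * ω) y := by
    intro y
    have c0 : HasDerivAt (fun s : ℝ => (s : ℂ)) 1 y := Complex.ofRealCLM.hasDerivAt
    refine ((((c0.pow 2).const_mul ω).add (c0.const_mul (2 * b * ω))).add_const k).congr_deriv ?_
    push_cast
    ring
  have hqd : ∀ y : ℝ, d < y → HasDerivAt q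
      ((Complex.I * (2 * ω * y + 2 * b * ω) - μ) * g y) y := by
    intro y hy
    refine ((hWd y hy).mul ((hP y hy).add
      (((hKd y).const_mul Complex.I).mul (hu y hy)))).congr_deriv ?_
    have h1 := hy0 y hy
    have h2 := hyd y hy
    simp only [hg, Pi.add_apply, Pi.mul_apply]
    change _ * (P y + Complex.I * K y * u y) +
      W y * (-((K y ^ 2 / (y * (y - d)) + μ) * u y) + _) = _
    field_simp
    linear_combination (-W y * K y ^ 2 * u y) * Complex.I_sq
  -- The term `am` contributes only to Im ξ, so Re ξ = Im ω (r₊² + a²)/d.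
  have hξre : 0 < ξ.re := by
    have h1 : ξ = ((-(Complex.I * (ω * d ^ 2 + 2 * b * ω * d + k))) / (d : ℝ) : ℂ) := hξ
    rw [h1, Complex.div_ofReal_re, hk]
    refine div_pos ?_ hd
    simp [pow_two]
    rw [← hν]
    have p1 : 0 < ν * (d * d) := by positivity
    have p2 : 0 ≤ 2 * b * ν * d := by positivity
    have p3 := mul_nonneg hω.le (add_nonneg (mul_self_nonneg b) (mul_self_nonneg a))
    linarith
  have hV : ∀ᶠ y in atTop, HasDerivAt P (-((K y ^ 2 / (y * (y - d)) + μ) * u y)) y := by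
    filter_upwards [eventually_gt_atTop d] with y hy using hP y hy
  have hKO : ∀ δ : ℝ, 0 < δ → K =O[atTop] fun y => Real.exp (δ * y) := fun δ hδ =>
    isBigO_quadratic_exp ω (2 * b * ω) k hδ
  have hinv : (fun y : ℝ => ((y : ℂ) * (y - d))⁻¹) =O[atTop] fun _ => (1 : ℝ) := by
    refine IsBigO.of_bound 1 ?_
    filter_upwards [eventually_ge_atTop (d + 1)] with y hy
    rw [← Complex.ofReal_sub, ← Complex.ofReal_mul, norm_inv, Complex.norm_real,
      Real.norm_of_nonneg (by nlinarith), norm_one, mul_one]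
    exact inv_le_one_of_one_le₀ (by nlinarith)
  have hPO : P =O[atTop] fun y => Real.exp (2 * (ν / 8) * y) := by
    refine isBigO_exp_of_isBigO_deriv (by positivity) hV ?_
    have e1 : (fun y => K y ^ 2 * ((y : ℂ) * (y - d))⁻¹) =O[atTop]
        fun y => Real.exp (ν / 8 * y) := by
      have h := ((hKO (ν / 16) (by positivity)).pow 2).mul hinv
      refine h.congr_right fun y => ?_
      rw [mul_one, ← Real.exp_nat_mul]
      congr 1
      push_cast
      ring
    have e2 : (fun _ : ℝ => μ) =O[atTop] fun y => Real.exp (ν / 8 * y) :=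
      ((isBigO_ofReal_pow_exp 0 (δ := ν / 8) (by positivity)).const_mul_left μ).congr_left
        fun y => by simp
    exact (((e1.add e2).mul hbdd).neg_left).congr_right fun y => by rw [mul_one]
  have hWO := isBigO_horizonWeight hd ω η ξ hξre.le (δ := ν / 4) (by positivity)
  have hmono : ∀ {f : ℝ → ℂ} {α β : ℝ}, α ≤ β → (f =O[atTop] fun y => Real.exp (α * y)) →
      f =O[atTop] fun y => Real.exp (β * y) := fun hαβ hf => hf.trans <| by
    refine IsBigO.of_bound 1 ?_
    filter_upwards [eventually_ge_atTop 0] with y hy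
    rw [one_mul, Real.norm_of_nonneg (Real.exp_pos _).le, Real.norm_of_nonneg (Real.exp_pos _).le]
    gcongr
  have hgO : g =O[atTop] fun y => Real.exp (3 / 2 * ν * y) := by
    refine hmono (α := ν + ν / 4) (by linarith) ?_
    exact (hWO.mul hbdd).congr_right fun y => by rw [mul_one]
  -- The rates add up as (ν + ν/4) + ν/4 = 3ν/2, below the required 2ν.
  have hqO : q =O[atTop] fun y => Real.exp (3 / 2 * ν * y) := by
    have e1 := (((hKO (2 * (ν / 8)) (by positivity)).const_mul_left Complex.I).mul
      hbdd).congr_right (fun y => mul_one (Real.exp (2 * (ν / 8) * y)))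
    refine (hWO.mul (hPO.add e1)).congr_right fun y => ?_
    rw [← Real.exp_add, ← hν]
    ring_nf
  have hAc : ContinuousAt (fun y : ℝ => Complex.exp (-(Complex.I * ω * y) + η * Real.log y)) d := by
    have : ContinuousAt (fun y : ℝ => Real.log y) d := Real.continuousAt_log hd.ne'
    fun_prop
  have hAt := hAc.tendsto.mono_left (nhdsWithin_le_nhds (s := Ioi d))
  have hvt : Tendsto v (𝓝[>] d) (𝓝 (v d)) :=
    (hv.continuousOn d self_mem_Ici).mono_left (nhdsWithin_mono d Ioi_subset_Ici_self)
  have hv't : Tendsto (derivWithin v (Ici d)) (𝓝[>] d) (𝓝 (derivWithin v (Ici d) d)) :=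
    ((hv.continuousOn_derivWithin (uniqueDiffOn_Ici d) le_rfl) d self_mem_Ici).mono_left
      (nhdsWithin_mono d Ioi_subset_Ici_self)
  have hEt := tendsto_cexp_mul_log_sub (d := d) hξre
  have hWeq : ∀ y, W y = Complex.exp (-(Complex.I * ω * y) + η * Real.log y) *
      Complex.exp (ξ * Real.log (y - d)) := fun y => by
    rw [hW, horizonWeight, ← Complex.exp_add]
  have hWt : Tendsto W (𝓝[>] d) (𝓝 0) := by
    have h := hAt.mul hEt
    rw [mul_zero] at h
    exact h.congr fun y => (hWeq y).symm
  have hut : Tendsto u (𝓝[>] d) (𝓝 0) := by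
    have h := hEt.mul hvt
    rw [zero_mul] at h
    refine h.congr' ?_
    filter_upwards [self_mem_nhdsWithin] with y hy using (huv y hy).symm
  -- The flux is computed from the factorisation at the horizon, where differentiability of `v` up
  -- to the endpoint enters.
  have hPeq : ∀ y : ℝ, d < y → P y = Complex.exp (ξ * Real.log (y - d)) *
      (ξ * y * v y + y * (y - d) * derivWithin v (Ici d) y) := by
    intro y hy
    have c2 := (((hasDerivAt_id y).sub_const d).log (sub_pos.2 hy).ne').ofReal_comp
    have c3 : HasDerivAt v (derivWithin v (Ici d) y) y :=
      ((hv.differentiableOn one_ne_zero) y hy.le).hasDerivWithinAt.hasDerivAt (Ici_mem_nhds hy)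
    have c4 := ((c2.const_mul ξ).cexp.mul c3)
    have c5 := (hu y hy).unique (c4.congr_of_eventuallyEq (by
      filter_upwards [Ioi_mem_nhds hy] with z hz using huv z hz))
    have h1 := hy0 y hy
    have h2 := hyd y hy
    rw [div_eq_iff (mul_ne_zero h1 h2)] at c5
    rw [c5]
    simp only [id]
    push_cast
    field_simp
  have hyt : Tendsto (fun y : ℝ => (y : ℂ)) (𝓝[>] d) (𝓝 d) :=
    (Complex.continuous_ofReal.tendsto d).mono_left nhdsWithin_le_nhds
  have hPt : Tendsto P (𝓝[>] d) (𝓝 0) := by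
    have h := hEt.mul (((hyt.const_mul ξ).mul hvt).add
      ((hyt.mul (hyt.sub_const (d : ℂ))).mul hv't))
    rw [zero_mul] at h
    refine h.congr' ?_
    filter_upwards [self_mem_nhdsWithin] with y hy using (hPeq y hy).symm
  have hKt : Tendsto K (𝓝[>] d) (𝓝 (K d)) :=
    (hKd d).continuousAt.tendsto.mono_left nhdsWithin_le_nhds
  have hgt : Tendsto g (𝓝[>] d) (𝓝 0) := by simpa using hWt.mul hut
  have hqt : Tendsto q (𝓝[>] d) (𝓝 0) := by
    simpa using hWt.mul (hPt.add ((hKt.const_mul Complex.I).mul hut))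
  obtain ⟨C₁, hC₁⟩ := exists_norm_le_exp
    (fun y hy => (hgd y hy).continuousAt.continuousWithinAt) hgt hgO
  obtain ⟨C₂, hC₂⟩ := exists_norm_le_exp
    (fun y hy => (hqd y hy).continuousAt.continuousWithinAt) hqt hqO
  refine ⟨3 / 2 * ν, max C₁ C₂, by linarith, hgd, hqd, hgt, hqt, fun y hy => ?_, fun y hy => ?_⟩
  · refine (hC₁ y hy).trans ?_
    gcongr
    exact le_max_left _ _
  · refine (hC₂ y hy).trans ?_
    gcongr
    exact le_max_right _ _

/-! ### Return to the Kerr–Newman radial equation. -/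

theorem Subextremal.rPlus_sub_rMinus_pos {M a Q : ℝ} (h : Subextremal M a Q) :
    0 < rPlus M a Q - rMinus M a Q := by
  have hs : 0 < Real.sqrt (M ^ 2 - a ^ 2 - Q ^ 2) :=
    Real.sqrt_pos.2 (by have := h.2; linarith)
  unfold rPlus rMinus
  linarith

theorem Subextremal.rMinus_nonneg {M a Q : ℝ} (h : Subextremal M a Q) : 0 ≤ rMinus M a Q := by
  have hs : Real.sqrt (M ^ 2 - a ^ 2 - Q ^ 2) ≤ M :=
    Real.sqrt_le_iff.2 ⟨h.1.le, by nlinarith [sq_nonneg a, sq_nonneg Q]⟩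
  unfold rMinus
  linarith

/-- An outgoing function at a frequency in the upper half-plane is bounded near infinity. -/
theorem Outgoing.isBigO_one {M a Q : ℝ} (hsub : Subextremal M a Q) {ω : ℂ} (hω : 0 < ω.im)
    {R : ℝ → ℂ} (h : Outgoing M a Q ω R) : R =O[atTop] fun _ => (1 : ℝ) := by
  obtain ⟨C, hC⟩ := h
  set r₀ := rPlus M a Q + 1 with hr₀
  have hmono : MonotoneOn (rStar M a Q) (Ioi (rPlus M a Q)) := by
    refine monotoneOn_of_deriv_nonneg (convex_Ioi _)
      (fun r hr => (hasDerivAt_rStar hsub hr).continuousAt.continuousWithinAt)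
      (fun r hr => (hasDerivAt_rStar hsub (interior_subset hr)).differentiableAt.differentiableWithinAt)
      fun r hr => ?_
    have hr' : rPlus M a Q < r := interior_subset hr
    rw [(hasDerivAt_rStar hsub hr').deriv, horizonFn_eq hsub]
    have h1 : 0 < r - rPlus M a Q := sub_pos.2 hr'
    have h2 : 0 < r - rMinus M a Q := by linarith [hsub.rPlus_sub_rMinus_pos]
    positivity
  have hexp : (fun r : ℝ => Complex.exp (Complex.I * ω * rStar M a Q r)) =O[atTop]
      fun _ => (1 : ℝ) := by
    refine IsBigO.of_bound (Real.exp (-(ω.im * rStar M a Q r₀))) ?_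
    filter_upwards [eventually_ge_atTop r₀] with r hr
    have h1 : rStar M a Q r₀ ≤ rStar M a Q r :=
      hmono (show rPlus M a Q < r₀ by linarith) (show rPlus M a Q < r by linarith) hr
    rw [Complex.norm_exp, norm_one, mul_one]
    refine Real.exp_le_exp.2 ?_
    simp
    gcongr
  have hinv : (fun r : ℝ => (r : ℂ)⁻¹) =O[atTop] fun _ => (1 : ℝ) := by
    refine IsBigO.of_bound 1 ?_
    filter_upwards [eventually_ge_atTop 1] with r hr
    rw [norm_inv, Complex.norm_real, Real.norm_of_nonneg (by linarith), norm_one, mul_one]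
    exact inv_le_one_of_one_le₀ hr
  have hsum : (fun r : ℝ => ∑ k ∈ Finset.range (1 + 1), C k / (r : ℂ) ^ k) =O[atTop]
      fun _ => (1 : ℝ) := by
    refine IsBigO.fun_sum fun k _ => ?_
    have := ((hinv.pow k).const_mul_left (C k))
    refine this.congr (fun r => ?_) fun r => by simp
    rw [inv_pow, div_eq_mul_inv]
  have hrem : (fun r : ℝ => (r ^ (1 + 2))⁻¹) =O[atTop] fun _ => (1 : ℝ) := by
    refine IsBigO.of_bound 1 ?_
    filter_upwards [eventually_ge_atTop 1] with r hr
    have h1 : 1 ≤ r ^ (1 + 2) := one_le_pow₀ hr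
    rw [Real.norm_of_nonneg (by positivity), norm_one, mul_one]
    exact inv_le_one_of_one_le₀ h1
  have hmain := ((hexp.mul hinv).mul hsum).congr_right (fun r => by norm_num : ∀ r : ℝ, _ = (1 : ℝ))
  -- The expansion with N = 1 suffices: exp(iωr*) is bounded for large r because r* is increasing
  -- and Im ω > 0.
  refine (((hC 1 le_rfl).trans hrem).add hmain).congr_left fun r => ?_
  rw [div_eq_mul_inv]
  ring

/-- Mode stability for the radial equation. -/
theorem IsRadialSolution.eq_zero {M a Q : ℝ} (hsub : Subextremal M a Q) {ω : ℂ} (hω : 0 < ω.im)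
    {m : ℤ} {lam : ℂ} (hlam : (conj ω * lam).im ≤ 0) {R : ℝ → ℂ}
    (hR : IsRadialSolution M a Q ω m lam R) (hH : HorizonRegular M a Q ω m R)
    (hO : Outgoing M a Q ω R) {r : ℝ} (hr : rPlus M a Q < r) : R r = 0 := by
  obtain ⟨hRc, hode⟩ := hR
  obtain ⟨v, hv, hvR⟩ := hH
  set b := rMinus M a Q with hb
  set d := rPlus M a Q - b with hd
  have hd0 : 0 < d := hsub.rPlus_sub_rMinus_pos
  have hshift : ∀ y : ℝ, d < y → rPlus M a Q < y + b := fun y hy => by linarith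
  have hΔ : ∀ y : ℝ, horizonFn M a Q (y + b) = y * (y - d) := fun y => by
    rw [horizonFn_eq hsub, hd]
    ring
  have hRd : ∀ x : ℝ, rPlus M a Q < x → HasDerivAt R (deriv R x) x := fun x hx =>
    ((hRc.differentiableOn two_ne_zero).differentiableAt (Ioi_mem_nhds hx)).hasDerivAt
  have hRd' : ∀ x : ℝ, rPlus M a Q < x → DifferentiableAt ℝ (deriv R) x := fun x hx =>
    ((hRc.deriv_of_isOpen isOpen_Ioi (m := 1) (by norm_num)).differentiableOn
      one_ne_zero).differentiableAt (Ioi_mem_nhds hx)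
  set μ : ℂ := 2 * a * m * ω - a ^ 2 * ω ^ 2 - lam with hμ
  set k : ℂ := ω * (b ^ 2 + a ^ 2) - a * m with hk
  have hrp : rPlus M a Q = d + b := by rw [hd]; ring
  have hxi : horizonExponent M a Q ω m =
      -(Complex.I * (ω * d ^ 2 + 2 * b * ω * d + k)) / d := by
    rw [horizonExponent, ← hb, ← hd, hk]
    have h0 := hΔ d
    rw [sub_self, mul_zero, horizonFn] at h0
    have h1 : (2 * M * rPlus M a Q - Q ^ 2 : ℝ) = (d + b) ^ 2 + a ^ 2 := by
      rw [hrp]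
      linarith
    rw [h1]
    congr 1
    push_cast
    ring
  obtain ⟨κ, C, hκ, hreg⟩ := exists_isRegularConfluentHeun (μ := μ) hd0 hsub.rMinus_nonneg hω hk hxi
    (u := fun y => R (y + b))
    (P := fun y => (horizonFn M a Q (y + b) : ℂ) * deriv R (y + b)) (v := fun y => v (y + b))
    (fun y hy => by
      have h1 := (hRd _ (hshift y hy)).comp_add_const y b
      refine h1.congr_deriv ?_
      have h2 : (y : ℂ) * (y - d) ≠ 0 := by
        rw [← Complex.ofReal_sub, ← Complex.ofReal_mul]
        exact Complex.ofReal_ne_zero.2 (mul_pos (hd0.trans hy) (sub_pos.2 hy)).ne'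
      rw [hΔ, eq_div_iff h2]
      push_cast
      ring)
    (fun y hy => by
      have hx := hshift y hy
      have h1 : DifferentiableAt ℝ (fun r' : ℝ => (horizonFn M a Q r' : ℂ) * deriv R r') (y + b) := by
        have h2 : DifferentiableAt ℝ (fun r' : ℝ => (horizonFn M a Q r' : ℂ)) (y + b) := by
          unfold horizonFn
          fun_prop
        exact h2.mul (hRd' _ hx)
      have h3 := h1.hasDerivAt.comp_add_const y b
      refine h3.congr_deriv ?_
      have h4 := hode _ hx
      have h5 : (y : ℂ) * (y - d) ≠ 0 := by
        rw [← Complex.ofReal_sub, ← Complex.ofReal_mul]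
        exact Complex.ofReal_ne_zero.2 (mul_pos (hd0.trans hy) (sub_pos.2 hy)).ne'
      -- This is 2Mr - Q² = r² + a² - Δ, which completes the potential to K²/Δ + μ.
      have h6 : 2 * (M : ℂ) * ((y + b : ℝ) : ℂ) - (Q : ℂ) ^ 2
          = ((y + b : ℝ) : ℂ) ^ 2 + (a : ℂ) ^ 2 - (y : ℂ) * (y - d) := by
        have h7 := hΔ y
        rw [horizonFn] at h7
        have h8 : 2 * M * (y + b) - Q ^ 2 = (y + b) ^ 2 + a ^ 2 - y * (y - d) := by linarith
        exact_mod_cast h8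
      rw [eq_neg_of_add_eq_zero_left h4, hΔ, h6, hk, hμ]
      push_cast
      congr 2
      have h9 : (y : ℂ) ≠ 0 := left_ne_zero_of_mul h5
      have h10 : (y : ℂ) - d ≠ 0 := right_ne_zero_of_mul h5
      clear_value b d
      rw [← hb]
      field_simp
      ring)
    ((hv.of_le (by exact_mod_cast le_top)).comp (by fun_prop) fun y hy => by
      have : d ≤ y := hy
      show rPlus M a Q ≤ y + b
      linarith)
    (fun y hy => by
      have hpos : 0 < y + b - rPlus M a Q := by linarith
      have hne : ((y + b - rPlus M a Q : ℝ) : ℂ) ≠ 0 := Complex.ofReal_ne_zero.2 hpos.ne'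
      have hyd : y - d = y + b - rPlus M a Q := by rw [hrp]; ring
      rw [hvR _ (hshift y hy), Complex.cpow_def_of_ne_zero hne, hyd,
        ← Complex.ofReal_log hpos.le, mul_comm (R _), ← mul_assoc, ← Complex.exp_add]
      ring_nf
      simp)
    (by
      have := (hO.isBigO_one hsub hω).comp_tendsto (tendsto_atTop_add_const_right atTop b tendsto_id)
      exact this)
  have h0 := hreg.eq_zero hd0 hsub.rMinus_nonneg hω hκ hlam hk hμ (y := r - b) (by linarith)
  simp only [sub_add_cancel] at h0
  exact (mul_eq_zero.1 h0).resolve_left (Complex.exp_ne_zero _)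

/-! ### From the radial function to the mode on the whole sphere. -/

theorem exists_sphPoint_eq (x : Sph) : ∃ θ ∈ Icc 0 Real.pi, ∃ φ : ℝ, sphPoint θ φ = x := by
  obtain ⟨x, hx⟩ := x
  have hn : x 0 ^ 2 + x 1 ^ 2 + x 2 ^ 2 = 1 := by
    rw [mem_sphere_zero_iff_norm, EuclideanSpace.norm_eq, Real.sqrt_eq_one] at hx
    simpa [Fin.sum_univ_three] using hx
  set z : ℂ := ⟨x 0, x 1⟩ with hz
  have hzn : ‖z‖ = Real.sin (Real.arccos (x 2)) := by
    rw [Real.sin_arccos, Complex.norm_def, Complex.normSq_apply, hz]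
    congr 1
    linarith
  have h2 : Real.cos (Real.arccos (x 2)) = x 2 :=
    Real.cos_arccos (by nlinarith [sq_nonneg (x 0), sq_nonneg (x 1)])
      (by nlinarith [sq_nonneg (x 0), sq_nonneg (x 1)])
  refine ⟨Real.arccos (x 2), ⟨Real.arccos_nonneg _, Real.arccos_le_pi _⟩, Complex.arg z, ?_⟩
  refine Subtype.ext ?_
  ext i
  fin_cases i
  · simp [sphPoint, ← hzn, Complex.norm_mul_cos_arg, hz]
  · simp [sphPoint, ← hzn, Complex.norm_mul_sin_arg, hz]
  · simpa [sphPoint] using h2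

theorem continuous_sphPoint (φ : ℝ) : Continuous fun θ => sphPoint θ φ := by
  refine Continuous.subtype_mk ?_ _
  fun_prop

end KerrNewman

theorem theorem3p3 (M a Q : ℝ) (hsub : KerrNewman.Subextremal M a Q)
    (ω : ℂ) (hω : 0 < ω.im) (m : ℤ)
    (ψ : ℝ × ℝ × KerrNewman.Sph → ℂ) (hψ : KerrNewman.IsModeSolution M a Q ω m ψ) :
    ∀ x ∈ KerrNewman.exterior M a Q, ψ x = 0 := by
  obtain ⟨-, ⟨hsmooth, -⟩, R, S, lam, hsep, hS, hR, hH, hO⟩ := hψ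
  rintro ⟨t, r, x⟩ hr
  have hr' : KerrNewman.rPlus M a Q < r := hr
  obtain ⟨θ, hθ, φ, rfl⟩ := KerrNewman.exists_sphPoint_eq x
  have hR0 := hR.eq_zero hsub hω (hS.im_conj_mul_nonpos hω) hH hO hr'
  have hcont : Continuous fun θ' => ψ (t, r, KerrNewman.sphPoint θ' φ) :=
    hsmooth.continuousOn.comp_continuous
      (continuous_const.prodMk (continuous_const.prodMk (KerrNewman.continuous_sphPoint φ)))
      fun _ => hr
  have hzero : Set.EqOn (fun θ' => ψ (t, r, KerrNewman.sphPoint θ' φ)) (fun _ => 0)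
      (Set.Ioo 0 Real.pi) := fun θ' hθ' => by
    have h := hsep t r θ' φ hr' hθ'
    rw [hR0] at h
    simpa [KerrNewman.inCoords] using h
  -- The separated form holds only off the poles; continuity of `ψ` along the meridian covers θ = 0
  -- and θ = π.
  have hcl := hzero.closure hcont continuous_const
  rw [closure_Ioo Real.pi_pos.ne] at hcl
  exact hcl hθ
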